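/- Let $E_0,E_1$ be Banach spaces with $E_1$ continuously and densely embedded in $E_0$. For $\theta\in(0,1)$ let $E_\theta=(E_0,E_1)^0_{\theta,\infty}$ be the continuous interpolation space. For $T>0$ and $\nu\in(0,1)$ let $BC_{1-\nu}([0,T],E)$ be the set of $v\in C((0,T],E)$ such that $t^{1-\nu}v(t)$ is bounded on $(0,T]$ and tends to $0$ as $t\to0^+$, and put $\mathbb E_{0,\nu}([0,T])=BC_{1-\nu}([0,T],E_0)$ and $$\mathbb E_{1,\nu}([0,T])=\{v\in C^1((0,T],E_0): v,\dot v\in BC_{1-\nu}([0,T],E_0)\}\cap BC_{1-\nu}([0,T],E_1),$$ with norm $\|v\|_{\mathbb E_{1,\nu}([0,T])}=\sup_{0<t\le T}t^{1-\nu}(|\dot v(t)|_{E_0}+|v(t)|_{E_1})$; for such $v$, $v(0)$ denotes the limit of $v(t)$ in $E_0$ as $t\to0^+$. Let $\mathcal M_\nu(E_1,E_0)$ be the set of $B\in\mathcal L(E_1,E_0)$ such that, for some $T>0$ and for all $f\in\mathbb E_{0,\nu}([0,T])$ and $x\in E_\nu$, the problem $\dot v+Bv=f$ on $(0,T]$,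 $v(0)=x$, has a unique solution $v\in\mathbb E_{1,\nu}([0,T])$. Let $0<\mu<\beta<1$, let $V_\mu\subset E_\mu$ be open, and assume: (H1) $(A,F_1):V_\mu\to\mathcal M_\mu(E_1,E_0)\times E_0$ is locally Lipschitz continuous, where $V_\mu$ carries the norm of $E_\mu$ and $\mathcal M_\mu(E_1,E_0)$ the norm of $\mathcal L(E_1,E_0)$. (H2) $F_2:V_\mu\cap E_\beta\to E_0$, and there are $m\in\mathbb N$, $\beta_j\in[\mu,\beta]$ and $\rho_j\ge0$ with $\frac{\rho_j(\beta-\mu)+(\beta_j-\mu)}{1-\mu}\le1$ ($j=1,\dots,m$), such that for all $x_0\in V_\mu$ and $R>0$ there is $C_R=C_R(x_0)>0$ with $$|F_2(x_1)-F_2(x_2)|_{E_0}\le C_R\sum_{j=1}^m\bigl(1+|x_1|_{E_\beta}^{\rho_j}+|x_2|_{E_\beta}^{\rho_j}\bigr)|x_1-x_2|_{E_{\beta_j}}$$ for all $x_1,x_2\in\bar B_{E_\mu}(x_0,R)\cap V_\mu\cap E_\beta$. For $\nu\in(0,1)$, $T>0$ and $x\in V_\mu$, an $E_\nu$-solution on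 $[0,T]$ with initial value $x$ is a function $v\in\mathbb E_{1,\nu}([0,T])$ with values in $V_\mu$ such that $\dot v+A(v)v=F_1(v)+F_2(v)$ on $(0,T]$ and $v(0)=x$. **Proposition.** Let $\bar\mu\in[\beta,1)$ and $x_0\in V_\mu\cap E_{\bar\mu}$. Then there are constants $\tau,\varepsilon,\sigma>0$ (depending on $x_0$) such that $\bar B_{E_{\bar\mu}}(x_0,\varepsilon)\subset V_\mu$ and, for every $x\in\bar B_{E_{\bar\mu}}(x_0,\varepsilon)$, there is a unique $E_{\bar\mu}$-solution $u(\cdot,x)\in\mathbb E_{1,\bar\mu}([0,\tau])$ on $[0,\tau]$ with initial value $x$. Moreover $$\|u(\cdot,x_1)-u(\cdot,x_2)\|_{\mathbb E_{1,\bar\mu}([0,\tau])}\le\sigma|x_1-x_2|_{E_{\bar\mu}},\qquad x_1,x_2\in\bar B_{E_{\bar\mu}}(x_0,\varepsilon).$$ These solutions coincide with the $E_\mu$-solutions: for every $x\in\bar B_{E_{\bar\mu}}(x_0,\varepsilon)$, $u(\cdot,x)$ is also an $E_\mu$-solution on $[0,\tau]$, and for each $T>0$, every $E_\mu$-solution $v$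 on $[0,T]$ with initial value $x$ satisfies $v=u(\cdot,x)$ on $(0,\min\{T,\tau\}]$ and belongs to $\mathbb E_{1,\bar\mu}([0,T])$. -/

import Mathlib

open Filter Topology Set

namespace ContMaxReg

noncomputable section

variable {E₀ E₁ : Type*} [NormedAddCommGroup E₀] [NormedSpace ℝ E₀]
  [NormedAddCommGroup E₁] [NormedSpace ℝ E₁]

/-! Throughout, `i : E₁ →L[ℝ] E₀` is the continuous embedding of `E₁` into `E₀`. -/

/-- The `K`-functional `K(t,x) = inf { |a|_{E₀} + t |b|_{E₁} : x = a + b }` of the couple. -/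
def kFun (i : E₁ →L[ℝ] E₀) (t : ℝ) (x : E₀) : ℝ :=
  ⨅ b : E₁, ‖x - i b‖ + t * ‖b‖

/-- The continuous interpolation space `E_θ = (E₀, E₁)_{θ,∞}^0`, `0 < θ < 1`, as a subset of `E₀`:
all `x` with `t^{-θ} K(t,x) → 0` as `t → 0+`.
As `K(t,x) ≤ |x|_{E₀}`, the decay at `t → ∞` is automatic. -/
def interpSpace (i : E₁ →L[ℝ] E₀) (θ : ℝ) : Set E₀ :=
  {x | Tendsto (fun t : ℝ => t ^ (-θ) * kFun i t x) (𝓝[>] 0) (𝓝 0)}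

/-- The norm `|x|_{E_θ} = sup_{t > 0} t^{-θ} K(t,x)` of the interpolation space
(the supremum is finite on `interpSpace i θ`, see `bddAbove_interpNorm`). -/
def interpNorm (i : E₁ →L[ℝ] E₀) (θ : ℝ) (x : E₀) : ℝ :=
  ⨆ t : Ioi (0 : ℝ), (t : ℝ) ^ (-θ) * kFun i t x

theorem kFun_le_norm (i : E₁ →L[ℝ] E₀) {t : ℝ} (ht : 0 ≤ t) (x : E₀) : kFun i t x ≤ ‖x‖ := by
  have hb : BddBelow (range fun b : E₁ => ‖x - i b‖ + t * ‖b‖) :=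
    ⟨0, by rintro _ ⟨b, rfl⟩; positivity⟩
  simpa [kFun] using ciInf_le hb 0

theorem bddAbove_interpNorm (i : E₁ →L[ℝ] E₀) {θ : ℝ} (hθ : 0 ≤ θ) {x : E₀}
    (hx : x ∈ interpSpace i θ) :
    BddAbove (range fun t : Ioi (0 : ℝ) => (t : ℝ) ^ (-θ) * kFun i t x) := by
  have h1 : ∀ᶠ t in 𝓝[>] (0 : ℝ), t ^ (-θ) * kFun i t x < 1 :=
    (show Tendsto _ _ _ from hx).eventually (gt_mem_nhds one_pos)
  obtain ⟨δ, hδ, hδ'⟩ := mem_nhdsGT_iff_exists_Ioo_subset.1 h1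
  have hδ0 : (0 : ℝ) < δ := hδ
  refine ⟨max 1 (δ ^ (-θ) * ‖x‖), ?_⟩
  rintro _ ⟨⟨t, ht⟩, rfl⟩
  have ht0 : (0 : ℝ) < t := ht
  rcases lt_or_ge t δ with h | h
  · exact le_max_of_le_left (le_of_lt (hδ' ⟨ht0, h⟩))
  · refine le_max_of_le_right ?_
    have h2 : t ^ (-θ) ≤ δ ^ (-θ) := Real.rpow_le_rpow_of_nonpos hδ0 h (by linarith)
    calc t ^ (-θ) * kFun i t x ≤ t ^ (-θ) * ‖x‖ := by
          gcongr
          exact kFun_le_norm i ht0.le x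
      _ ≤ δ ^ (-θ) * ‖x‖ := by gcongr

/-- `V` is an open subset of the normed space `E_θ`. -/
def IsOpenInterp (i : E₁ →L[ℝ] E₀) (θ : ℝ) (V : Set E₀) : Prop :=
  V ⊆ interpSpace i θ ∧
    ∀ x ∈ V, ∃ r > 0, ∀ y ∈ interpSpace i θ, interpNorm i θ (y - x) < r → y ∈ V

/-- The closed ball of `E_θ` with centre `x₀` and radius `r`. -/
def closedBallInterp (i : E₁ →L[ℝ] E₀) (θ : ℝ) (x₀ : E₀) (r : ℝ) : Set E₀ :=
  {x | x ∈ interpSpace i θ ∧ interpNorm i θ (x - x₀) ≤ r}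

/-- `v ∈ BC_{1-μ}([0,T], E)`: `v` is continuous on `(0,T]`, `t^{1-μ} v(t)` is bounded there, and
`t^{1-μ} |v(t)| → 0` as `t → 0+`. Only the values of `v` on `(0,T]` matter. -/
structure MemBC {E : Type*} [NormedAddCommGroup E] (μ T : ℝ) (v : ℝ → E) : Prop where
  continuousOn : ContinuousOn v (Ioc 0 T)
  bounded : ∃ C : ℝ, ∀ t ∈ Ioc (0 : ℝ) T, t ^ (1 - μ) * ‖v t‖ ≤ C
  tendsto_zero : Tendsto (fun t : ℝ => t ^ (1 - μ) * ‖v t‖) (𝓝[>] 0) (𝓝 0)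

/-- The time derivative in `E₀`, on `(0,T]`, of a function with values in `E₁`
(one-sided at `t = T`). -/
def timeDeriv (i : E₁ →L[ℝ] E₀) (T : ℝ) (v : ℝ → E₁) (t : ℝ) : E₀ :=
  derivWithin (fun s => i (v s)) (Ioc 0 T) t

/-- `v ∈ 𝔼_{1,μ}([0,T]) = BC_{1-μ}^1([0,T], E₀) ∩ BC_{1-μ}([0,T], E₁)`. Elements are represented by
functions `ℝ → E₁`, of which only the values on `(0,T]` matter. -/
structure MemE1 (i : E₁ →L[ℝ] E₀) (μ T : ℝ) (v : ℝ → E₁) : Prop where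
  differentiableOn : DifferentiableOn ℝ (fun t => i (v t)) (Ioc 0 T)
  memBC_zero : MemBC μ T (fun t => i (v t))
  memBC_deriv : MemBC μ T (timeDeriv i T v)
  memBC_one : MemBC μ T v

/-- The norm `sup_{0 < t ≤ T} t^{1-μ} (|v'(t)|_{E₀} + |v(t)|_{E₁})` of `𝔼_{1,μ}([0,T])`. -/
def normE1 (i : E₁ →L[ℝ] E₀) (μ T : ℝ) (v : ℝ → E₁) : ℝ :=
  ⨆ t : Ioc (0 : ℝ) T, (t : ℝ) ^ (1 - μ) * (‖timeDeriv i T v t‖ + ‖v t‖)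

/-- The initial condition `v(0) = x`: the trace of `v` at `t = 0`, taken in `E₀`, is `x`. -/
def HasTrace (i : E₁ →L[ℝ] E₀) (v : ℝ → E₁) (x : E₀) : Prop :=
  Tendsto (fun t => i (v t)) (𝓝[>] 0) (𝓝 x)

/-- `v ∈ 𝔼_{1,μ}([0,T])` solves the linear problem `v' + B v = f` on `(0,T]`, `v(0) = x`. -/
def IsLinearSolution (i : E₁ →L[ℝ] E₀) (μ T : ℝ) (B : E₁ →L[ℝ] E₀) (f : ℝ → E₀) (x : E₀)
    (v : ℝ → E₁) : Prop :=
  MemE1 i μ T v ∧ HasTrace i v x ∧ ∀ t ∈ Ioc (0 : ℝ) T, timeDeriv i T v t + B (v t) = f t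

/-- The class `ℳ_μ(E₁, E₀)` of operators with continuous maximal regularity: for some `T > 0`,
every `f ∈ 𝔼_{0,μ}([0,T]) = BC_{1-μ}([0,T], E₀)` and every `x ∈ E_μ`, the linear problem has a
unique solution in `𝔼_{1,μ}([0,T])`. -/
def maxReg (i : E₁ →L[ℝ] E₀) (μ : ℝ) : Set (E₁ →L[ℝ] E₀) :=
  {B | ∃ T > 0, ∀ f : ℝ → E₀, MemBC μ T f → ∀ x ∈ interpSpace i μ,
    ∃ v, IsLinearSolution i μ T B f x v ∧
      ∀ w, IsLinearSolution i μ T B f x w → EqOn w v (Ioc 0 T)}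

/-- `(A, F₁) ∈ C^{1-}(V, ℳ_μ(E₁,E₀) × E₀)`: `A` takes values in `ℳ_μ(E₁,E₀)` on `V`, and `A`, `F₁`
are locally Lipschitz continuous on `V ⊆ E_μ` in the norm of `E_μ`. -/
def LocLipCoefficients (i : E₁ →L[ℝ] E₀) (μ : ℝ) (V : Set E₀) (A : E₀ → E₁ →L[ℝ] E₀)
    (F₁ : E₀ → E₀) : Prop :=
  (∀ x ∈ V, A x ∈ maxReg i μ) ∧
  ∀ x ∈ V, ∃ r > 0, ∃ L : ℝ, ∀ y ∈ V, ∀ z ∈ V,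
    interpNorm i μ (y - x) < r → interpNorm i μ (z - x) < r →
      ‖A y - A z‖ ≤ L * interpNorm i μ (y - z) ∧ ‖F₁ y - F₁ z‖ ≤ L * interpNorm i μ (y - z)

/-- The structural condition on `F₂ : V ∩ E_β → E₀` with exponents `ρ j ≥ 0`,
`b j ∈ [μ, β]` satisfying `(ρ j (β - μ) + (b j - μ)) / (1 - μ) ≤ 1`.
Only the values of `F₂` on `V ∩ E_β` matter. -/
def SingularStructure (i : E₁ →L[ℝ] E₀) (μ β : ℝ) (V : Set E₀) (F₂ : E₀ → E₀) : Prop :=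
  ∃ (m : ℕ) (b ρ : Fin m → ℝ),
    (∀ j, b j ∈ Icc μ β ∧ 0 ≤ ρ j ∧ (ρ j * (β - μ) + (b j - μ)) / (1 - μ) ≤ 1) ∧
    ∀ x₀ ∈ V, ∀ R > 0, ∃ C > 0,
      ∀ x₁ ∈ closedBallInterp i μ x₀ R ∩ (V ∩ interpSpace i β),
      ∀ x₂ ∈ closedBallInterp i μ x₀ R ∩ (V ∩ interpSpace i β),
        ‖F₂ x₁ - F₂ x₂‖ ≤ C * ∑ j, (1 + interpNorm i β x₁ ^ ρ j + interpNorm i β x₂ ^ ρ j) *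
          interpNorm i (b j) (x₁ - x₂)

/-- `v ∈ 𝔼_{1,ν}([0,T])` solves the quasilinear problem
`v' + A(v) v = F₁(v) + F₂(v)` on `(0,T]`, `v(0) = x`, with values in `V`. -/
def IsSolution (i : E₁ →L[ℝ] E₀) (ν T : ℝ) (V : Set E₀) (A : E₀ → E₁ →L[ℝ] E₀)
    (F₁ F₂ : E₀ → E₀) (x : E₀) (v : ℝ → E₁) : Prop :=
  MemE1 i ν T v ∧ x ∈ V ∧ HasTrace i v x ∧
  ∀ t ∈ Ioc (0 : ℝ) T, i (v t) ∈ V ∧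
    timeDeriv i T v t + A (i (v t)) (v t) = F₁ (i (v t)) + F₂ (i (v t))

end

end ContMaxReg

open ContMaxReg

/-!
Maximal regularity at the weight `μ` on some interval holds at every weight `ν ∈ [μ, 1)` and on
every shorter interval, with constants that do not depend on the interval: the closed graph theorem
gives a bound at the weight `μ`, and truncating the right-hand side at time `t` and extending it
homogeneously turns this bound into one at the weight `ν`. A nonzero initial value `x ∈ E_ν` is
reduced to zero by an extension of `x` in `𝔼_{1,ν}`, built from dyadic means of near-optimal
decompositions in the `K`-functional.

With the coefficient `A(x₀)` frozen, the quasilinear problem is a fixed point problem for its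
right-hand side. By interpolation, a solution of weight `ν` is bounded in `E_θ`, `ν ≤ θ < 1`, by
`o(t^{ν-θ})`, and the inequality on the exponents in (H2) is what makes `F₂` contract with these
singularities. At the weight `μ'` this gives existence and Lipschitz dependence. At the weight `μ`,
where the borderline case of the inequality is covered by the `o`, it shows that two solutions
agree near `0`, and restarting at positive times propagates the agreement. Hence an `E_μ`-solution
coincides near `0` with the `E_{μ'}`-solution of the same initial value and inherits its weight.
-/

namespace ContMaxReg

section Limits

theorem tendsto_zero_iff_eventually_le {α : Type*} {l : Filter α} {φ : α → ℝ}
    (hφ : ∀ᶠ a in l, 0 ≤ φ a) : Tendsto φ l (𝓝 0) ↔ ∀ ε > 0, ∀ᶠ a in l, φ a ≤ ε := by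
  refine ⟨fun h ε hε => h.eventually (ge_mem_nhds hε), fun h => tendsto_order.2
    ⟨fun a ha => hφ.mono fun _ => ha.trans_le, fun a ha => ?_⟩⟩
  exact (h (a / 2) (half_pos ha)).mono fun _ ht => ht.trans_lt (half_lt_self ha)

theorem eventually_nhdsGT_zero_iff {P : ℝ → Prop} {T : ℝ} (hT : 0 < T) :
    (∀ᶠ t in 𝓝[>] 0, P t) ↔ ∃ δ ∈ Ioc 0 T, ∀ t ∈ Ioc 0 δ, P t := by
  rw [Filter.Eventually, mem_nhdsGT_iff_exists_Ioc_subset]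
  constructor
  · rintro ⟨δ, hδ, h⟩
    exact ⟨min δ T, ⟨lt_min hδ hT, min_le_right _ _⟩,
      fun t ht => h ⟨ht.1, ht.2.trans (min_le_left _ _)⟩⟩
  · rintro ⟨δ, hδ, h⟩
    exact ⟨δ, hδ.1, h⟩

theorem eventually_nhdsGT_zero_forall_Ioc {P : ℝ → Prop} (h : ∀ᶠ t in 𝓝[>] 0, P t) :
    ∀ᶠ δ in 𝓝[>] 0, ∀ t ∈ Ioc 0 δ, P t := by
  obtain ⟨δ, hδ, hP⟩ := mem_nhdsGT_iff_exists_Ioc_subset.1 h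
  filter_upwards [Ioc_mem_nhdsGT hδ] with δ' hδ' t ht using hP ⟨ht.1, ht.2.trans hδ'.2⟩

theorem tendsto_rpow_nhdsGT_zero {p : ℝ} (hp : 0 < p) :
    Tendsto (fun t : ℝ => t ^ p) (𝓝[>] 0) (𝓝 0) := by
  have h := (Real.continuousAt_rpow_const 0 p (Or.inr hp.le)).tendsto
  rw [Real.zero_rpow hp.ne'] at h
  exact h.mono_left nhdsWithin_le_nhds

theorem rpow_neg_mul_le_iff {t θ a M : ℝ} (ht : 0 < t) : t ^ (-θ) * a ≤ M ↔ a ≤ t ^ θ * M := by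
  rw [Real.rpow_neg ht.le, inv_mul_le_iff₀ (Real.rpow_pos_of_pos ht θ)]

end Limits

section Interpolation

variable {E₀ E₁ : Type*} [NormedAddCommGroup E₀] [NormedSpace ℝ E₀]
  [NormedAddCommGroup E₁] [NormedSpace ℝ E₁] (i : E₁ →L[ℝ] E₀)

theorem kFun_le {t : ℝ} (ht : 0 ≤ t) (x : E₀) (b : E₁) : kFun i t x ≤ ‖x - i b‖ + t * ‖b‖ :=
  ciInf_le ⟨0, by rintro _ ⟨b, rfl⟩; positivity⟩ b

theorem le_kFun {t c : ℝ} {x : E₀} (h : ∀ b : E₁, c ≤ ‖x - i b‖ + t * ‖b‖) : c ≤ kFun i t x :=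
  le_ciInf h

theorem exists_lt_of_kFun_lt {t c : ℝ} {x : E₀} (h : kFun i t x < c) :
    ∃ b : E₁, ‖x - i b‖ + t * ‖b‖ < c :=
  exists_lt_of_ciInf_lt h

theorem kFun_nonneg {t : ℝ} (ht : 0 ≤ t) (x : E₀) : 0 ≤ kFun i t x :=
  le_kFun i fun b => by positivity

theorem kFun_zero {t : ℝ} (ht : 0 ≤ t) : kFun i t (0 : E₀) = 0 :=
  le_antisymm (by simpa using kFun_le_norm i ht (0 : E₀)) (kFun_nonneg i ht 0)

theorem kFun_apply_le {t : ℝ} (ht : 0 ≤ t) (b : E₁) : kFun i t (i b) ≤ t * ‖b‖ := by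
  simpa using kFun_le i ht (i b) b

theorem kFun_neg (t : ℝ) (x : E₀) : kFun i t (-x) = kFun i t x := by
  refine (Equiv.neg E₁).iInf_congr fun b => ?_
  rw [Equiv.neg_apply, map_neg, norm_neg, sub_neg_eq_add, ← neg_add', norm_neg]

theorem kFun_add_le {t : ℝ} (ht : 0 ≤ t) (x y : E₀) :
    kFun i t (x + y) ≤ kFun i t x + kFun i t y := by
  refine le_of_forall_pos_le_add fun ε hε => ?_
  obtain ⟨a, ha⟩ := exists_lt_of_kFun_lt i (lt_add_of_pos_right (kFun i t x) (half_pos hε))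
  obtain ⟨b, hb⟩ := exists_lt_of_kFun_lt i (lt_add_of_pos_right (kFun i t y) (half_pos hε))
  calc kFun i t (x + y) ≤ ‖x + y - i (a + b)‖ + t * ‖a + b‖ := kFun_le i ht _ _
    _ ≤ (‖x - i a‖ + ‖y - i b‖) + t * (‖a‖ + ‖b‖) := by
        rw [map_add, add_sub_add_comm]
        gcongr <;> exact norm_add_le _ _
    _ ≤ kFun i t x + kFun i t y + ε := by linarith

theorem kFun_mono {s t : ℝ} (hs : 0 ≤ s) (hst : s ≤ t) (x : E₀) : kFun i s x ≤ kFun i t x :=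
  le_kFun i fun b => (kFun_le i hs x b).trans (by gcongr)

theorem kFun_le_div_mul {s t : ℝ} (hs : 0 < s) (hst : s ≤ t) (x : E₀) :
    kFun i t x ≤ t / s * kFun i s x := by
  have ht := hs.trans_le hst
  rw [← inv_mul_le_iff₀ (div_pos ht hs), inv_div]
  refine le_kFun i fun b => ?_
  calc s / t * kFun i t x ≤ s / t * (‖x - i b‖ + t * ‖b‖) := by gcongr; exact kFun_le i ht.le x b
    _ = s / t * ‖x - i b‖ + s * ‖b‖ := by field_simp
    _ ≤ ‖x - i b‖ + s * ‖b‖ := by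
        gcongr
        exact mul_le_of_le_one_left (norm_nonneg _) ((div_le_one ht).2 hst)

theorem kFun_le_two_mul {s t : ℝ} (ht : 0 < t) (hs : s ∈ Icc t (2 * t)) (x : E₀) :
    kFun i s x ≤ 2 * kFun i t x :=
  (kFun_mono i (ht.le.trans hs.1) hs.2 x).trans <|
    (kFun_le_div_mul i ht (by linarith) x).trans_eq (by rw [mul_div_cancel_right₀ _ ht.ne'])

theorem norm_le_mul_kFun_one (x : E₀) : ‖x‖ ≤ (1 + ‖i‖) * kFun i 1 x := by
  rw [← inv_mul_le_iff₀ (by positivity)]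
  refine le_kFun i fun b => ?_
  rw [inv_mul_le_iff₀ (by positivity)]
  calc ‖x‖ ≤ ‖x - i b‖ + ‖i b‖ := by simpa using norm_add_le (x - i b) (i b)
    _ ≤ ‖x - i b‖ + ‖i‖ * ‖b‖ := by gcongr; exact i.le_opNorm b
    _ ≤ (1 + ‖i‖) * (‖x - i b‖ + 1 * ‖b‖) := by
        nlinarith [norm_nonneg b, mul_nonneg (norm_nonneg i) (norm_nonneg (x - i b))]

theorem kFun_pos {t : ℝ} (ht : 0 < t) {x : E₀} (hx : x ≠ 0) : 0 < kFun i t x := by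
  have hone : 0 < kFun i 1 x :=
    pos_of_mul_pos_right ((norm_pos_iff.2 hx).trans_le (norm_le_mul_kFun_one i x)) (by positivity)
  rcases le_total t 1 with h | h
  · exact pos_of_mul_pos_right (hone.trans_le (kFun_le_div_mul i ht h x)) (by positivity)
  · exact hone.trans_le (kFun_mono i zero_le_one h x)

theorem interpNorm_nonneg (θ : ℝ) (x : E₀) : 0 ≤ interpNorm i θ x :=
  Real.iSup_nonneg fun t => mul_nonneg (Real.rpow_nonneg (le_of_lt t.2) _)
    (kFun_nonneg i (le_of_lt t.2) x)

variable {i} {θ θ' : ℝ} {x y z : E₀}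

theorem kFun_le_interpNorm (hθ : 0 ≤ θ) (hx : x ∈ interpSpace i θ) {t : ℝ} (ht : 0 < t) :
    kFun i t x ≤ t ^ θ * interpNorm i θ x :=
  (rpow_neg_mul_le_iff ht).1 (le_ciSup (bddAbove_interpNorm i hθ hx) ⟨t, ht⟩)

theorem interpNorm_le {M : ℝ} (h : ∀ t > 0, kFun i t x ≤ t ^ θ * M) : interpNorm i θ x ≤ M := by
  have : Nonempty (Ioi (0 : ℝ)) := ⟨⟨1, mem_Ioi.2 one_pos⟩⟩
  exact ciSup_le fun t => (rpow_neg_mul_le_iff t.2).2 (h t t.2)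

theorem mem_interpSpace_iff :
    x ∈ interpSpace i θ ↔ ∀ ε > 0, ∀ᶠ t in 𝓝[>] 0, kFun i t x ≤ t ^ θ * ε := by
  have hnonneg : ∀ᶠ t in 𝓝[>] (0 : ℝ), 0 ≤ t ^ (-θ) * kFun i t x := by
    filter_upwards [self_mem_nhdsWithin] with t ht
    exact mul_nonneg (Real.rpow_nonneg (le_of_lt ht) _) (kFun_nonneg i (le_of_lt ht) x)
  refine (tendsto_zero_iff_eventually_le hnonneg).trans (forall₂_congr fun ε _ =>
    eventually_congr ?_)
  filter_upwards [self_mem_nhdsWithin] with t ht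
  exact rpow_neg_mul_le_iff ht

theorem zero_mem_interpSpace : (0 : E₀) ∈ interpSpace i θ := by
  refine mem_interpSpace_iff.2 fun ε hε => ?_
  filter_upwards [self_mem_nhdsWithin] with t ht
  rw [kFun_zero i (le_of_lt ht)]
  exact mul_nonneg (Real.rpow_nonneg (le_of_lt ht) _) hε.le

theorem add_mem_interpSpace (hx : x ∈ interpSpace i θ) (hy : y ∈ interpSpace i θ) :
    x + y ∈ interpSpace i θ := by
  refine mem_interpSpace_iff.2 fun ε hε => ?_
  filter_upwards [self_mem_nhdsWithin, mem_interpSpace_iff.1 hx (ε / 2) (half_pos hε),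
    mem_interpSpace_iff.1 hy (ε / 2) (half_pos hε)] with t ht hxt hyt
  linarith [kFun_add_le i (le_of_lt ht) x y]

theorem neg_mem_interpSpace (hx : x ∈ interpSpace i θ) : -x ∈ interpSpace i θ := by
  simpa only [mem_interpSpace_iff, kFun_neg] using hx

theorem sub_mem_interpSpace (hx : x ∈ interpSpace i θ) (hy : y ∈ interpSpace i θ) :
    x - y ∈ interpSpace i θ := by
  simpa only [sub_eq_add_neg] using add_mem_interpSpace hx (neg_mem_interpSpace hy)

theorem interpSpace_anti (h : θ ≤ θ') : interpSpace i θ' ⊆ interpSpace i θ := by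
  intro x hx
  refine mem_interpSpace_iff.2 fun ε hε => ?_
  filter_upwards [Ioc_mem_nhdsGT one_pos, mem_interpSpace_iff.1 hx ε hε] with t ht hxt
  refine hxt.trans ?_
  gcongr ?_ * _
  exact Real.rpow_le_rpow_of_exponent_ge ht.1 ht.2 h

theorem apply_mem_interpSpace (hθ : θ < 1) (b : E₁) : i b ∈ interpSpace i θ := by
  refine mem_interpSpace_iff.2 fun ε hε => ?_
  have hlim : Tendsto (fun t : ℝ => t ^ (1 - θ) * ‖b‖) (𝓝[>] 0) (𝓝 0) := by
    simpa using (tendsto_rpow_nhdsGT_zero (sub_pos.2 hθ)).mul_const ‖b‖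
  filter_upwards [self_mem_nhdsWithin, hlim.eventually (ge_mem_nhds hε)] with t ht hε
  have ht : 0 < t := ht
  calc kFun i t (i b) ≤ t * ‖b‖ := kFun_apply_le i ht.le b
    _ = t ^ θ * (t ^ (1 - θ) * ‖b‖) := by
        rw [← mul_assoc, ← Real.rpow_add ht, add_sub_cancel, Real.rpow_one]
    _ ≤ t ^ θ * ε := by gcongr

theorem interpNorm_zero : interpNorm i θ (0 : E₀) = 0 :=
  le_antisymm (interpNorm_le fun t ht => by rw [kFun_zero i ht.le, mul_zero])
    (interpNorm_nonneg _ _ _)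

theorem interpNorm_neg (x : E₀) : interpNorm i θ (-x) = interpNorm i θ x := by
  simp only [interpNorm, kFun_neg]

theorem interpNorm_sub_comm (x y : E₀) : interpNorm i θ (x - y) = interpNorm i θ (y - x) := by
  rw [← interpNorm_neg, neg_sub]

theorem interpNorm_add_le (hθ : 0 ≤ θ) (hx : x ∈ interpSpace i θ) (hy : y ∈ interpSpace i θ) :
    interpNorm i θ (x + y) ≤ interpNorm i θ x + interpNorm i θ y :=
  interpNorm_le fun t ht => by
    linarith [kFun_add_le i ht.le x y, kFun_le_interpNorm hθ hx ht, kFun_le_interpNorm hθ hy ht]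

theorem interpNorm_le_sub_add (hθ : 0 ≤ θ) (hx : x ∈ interpSpace i θ)
    (hy : y ∈ interpSpace i θ) : interpNorm i θ x ≤ interpNorm i θ (x - y) + interpNorm i θ y := by
  simpa using interpNorm_add_le hθ (sub_mem_interpSpace hx hy) hy

theorem interpNorm_sub_le_sub_add_sub (hθ : 0 ≤ θ) (hx : x ∈ interpSpace i θ)
    (hy : y ∈ interpSpace i θ) (hz : z ∈ interpSpace i θ) :
    interpNorm i θ (x - z) ≤ interpNorm i θ (x - y) + interpNorm i θ (y - z) := by
  simpa using interpNorm_add_le hθ (sub_mem_interpSpace hx hy) (sub_mem_interpSpace hy hz)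

theorem norm_le_mul_interpNorm (hθ : 0 ≤ θ) (hx : x ∈ interpSpace i θ) :
    ‖x‖ ≤ (1 + ‖i‖) * interpNorm i θ x := by
  refine (norm_le_mul_kFun_one i x).trans ?_
  gcongr
  simpa using kFun_le_interpNorm hθ hx one_pos

theorem interpNorm_le_mul_of_le (hθ : 0 ≤ θ) (h : θ ≤ θ') (hx : x ∈ interpSpace i θ') :
    interpNorm i θ x ≤ (1 + ‖i‖) * interpNorm i θ' x := by
  have hN := interpNorm_nonneg i θ' x
  refine interpNorm_le fun t ht => ?_
  rcases le_total t 1 with ht1 | ht1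
  · calc kFun i t x ≤ t ^ θ' * interpNorm i θ' x := kFun_le_interpNorm (hθ.trans h) hx ht
      _ ≤ t ^ θ * ((1 + ‖i‖) * interpNorm i θ' x) := by
          gcongr ?_ * ?_
          · exact Real.rpow_le_rpow_of_exponent_ge ht ht1 h
          · exact le_mul_of_one_le_left hN (le_add_of_nonneg_right (norm_nonneg i))
  · calc kFun i t x ≤ ‖x‖ := kFun_le_norm i ht.le x
      _ ≤ (1 + ‖i‖) * interpNorm i θ' x := norm_le_mul_interpNorm (hθ.trans h) hx
      _ ≤ t ^ θ * ((1 + ‖i‖) * interpNorm i θ' x) :=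
          le_mul_of_one_le_left (by positivity) (Real.one_le_rpow ht1 hθ)

theorem interpNorm_apply_le (h0 : 0 ≤ θ) (h1 : θ ≤ 1) (b : E₁) :
    interpNorm i θ (i b) ≤ (1 + ‖i‖) * ‖b‖ := by
  refine interpNorm_le fun t ht => ?_
  rcases le_total t 1 with ht1 | ht1
  · calc kFun i t (i b) ≤ t ^ (1 : ℝ) * ‖b‖ := by simpa using kFun_apply_le i ht.le b
      _ ≤ t ^ θ * ((1 + ‖i‖) * ‖b‖) := by
          gcongr ?_ * ?_
          · exact Real.rpow_le_rpow_of_exponent_ge ht ht1 h1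
          · exact le_mul_of_one_le_left (norm_nonneg b) (le_add_of_nonneg_right (norm_nonneg i))
  · calc kFun i t (i b) ≤ ‖i‖ * ‖b‖ := (kFun_le_norm i ht.le _).trans (i.le_opNorm b)
      _ ≤ (1 + ‖i‖) * ‖b‖ := by gcongr; exact le_add_of_nonneg_left zero_le_one
      _ ≤ t ^ θ * ((1 + ‖i‖) * ‖b‖) :=
          le_mul_of_one_le_left (by positivity) (Real.one_le_rpow ht1 h0)

theorem interpNorm_apply_le_rpow_mul_rpow {μ : ℝ} (hμ : 0 ≤ μ) (hμθ : μ ≤ θ) (hμ1 : μ < 1)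
    (hθ1 : θ ≤ 1) (b : E₁) :
    interpNorm i θ (i b) ≤
      interpNorm i μ (i b) ^ ((1 - θ) / (1 - μ)) * ‖b‖ ^ ((θ - μ) / (1 - μ)) := by
  have hμ1' : 0 < 1 - μ := sub_pos.2 hμ1
  have hN := interpNorm_nonneg i μ (i b)
  set p := (1 - θ) / (1 - μ) with hp
  set q := (θ - μ) / (1 - μ) with hq
  have hp0 : 0 ≤ p := div_nonneg (sub_nonneg.2 hθ1) hμ1'.le
  have hq0 : 0 ≤ q := div_nonneg (sub_nonneg.2 hμθ) hμ1'.le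
  have hpq : p + q = 1 := by rw [hp, hq]; field_simp; ring
  refine interpNorm_le fun t ht => ?_
  have hk := kFun_nonneg i ht.le (i b)
  calc kFun i t (i b) = kFun i t (i b) ^ p * kFun i t (i b) ^ q := by
        rw [← Real.rpow_add_of_nonneg hk hp0 hq0, hpq, Real.rpow_one]
    _ ≤ (t ^ μ * interpNorm i μ (i b)) ^ p * (t * ‖b‖) ^ q := by
        gcongr
        · exact kFun_le_interpNorm hμ (apply_mem_interpSpace hμ1 b) ht
        · exact kFun_apply_le i ht.le b
    _ = t ^ (μ * p + q) * (interpNorm i μ (i b) ^ p * ‖b‖ ^ q) := by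
        rw [Real.mul_rpow (by positivity) hN, Real.mul_rpow ht.le (norm_nonneg b),
          Real.rpow_add ht, Real.rpow_mul ht.le]
        ring
    _ = t ^ θ * (interpNorm i μ (i b) ^ p * ‖b‖ ^ q) := by
        congr 2
        rw [hp, hq]; field_simp; ring

end Interpolation

section Weighted

open MeasureTheory

variable {E F : Type*} [NormedAddCommGroup E] [NormedAddCommGroup F] {μ ν T T' M N : ℝ}
  {f g : ℝ → E}

/-- The bound `sup_{0 < t ≤ T} t^{1-μ} |f(t)| ≤ M` on the norm of `BC_{1-μ}([0,T], E)`, stated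
without forming the supremum. -/
def WeightLE (μ T M : ℝ) (f : ℝ → E) : Prop :=
  ∀ t ∈ Ioc 0 T, t ^ (1 - μ) * ‖f t‖ ≤ M

theorem rpow_mul_norm_nonneg {t : ℝ} (ht : 0 ≤ t) (p : ℝ) (a : E) : 0 ≤ t ^ p * ‖a‖ :=
  mul_nonneg (Real.rpow_nonneg ht p) (norm_nonneg a)

theorem norm_le_mul_rpow {t : ℝ} (ht : 0 < t) {a : E} (h : t ^ (1 - μ) * ‖a‖ ≤ M) :
    ‖a‖ ≤ M * t ^ (μ - 1) := by
  rwa [← neg_sub 1 μ, Real.rpow_neg ht.le, ← div_eq_mul_inv,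
    le_div_iff₀' (Real.rpow_pos_of_pos ht _)]

theorem rpow_mul_norm_add_le {t : ℝ} (ht : 0 ≤ t) (p : ℝ) (a b : E) :
    t ^ p * ‖a + b‖ ≤ t ^ p * ‖a‖ + t ^ p * ‖b‖ := by
  rw [← mul_add]
  gcongr
  exact norm_add_le a b

theorem rpow_mul_norm_le {t : ℝ} (ht : t ∈ Ioc 0 T) (hμν : μ ≤ ν) (a : E) :
    t ^ (1 - μ) * ‖a‖ ≤ T ^ (ν - μ) * (t ^ (1 - ν) * ‖a‖) := by
  have ht0 := ht.1
  rw [← sub_add_sub_cancel 1 ν μ, add_comm, Real.rpow_add ht.1, mul_assoc]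
  gcongr
  exact ht.2

namespace WeightLE

theorem nonneg (hT : 0 < T) (hf : WeightLE μ T M f) : 0 ≤ M :=
  (rpow_mul_norm_nonneg hT.le _ _).trans (hf T ⟨hT, le_rfl⟩)

theorem mono (hf : WeightLE μ T M f) (h : M ≤ N) : WeightLE μ T N f :=
  fun t ht => (hf t ht).trans h

theorem mono_right (hf : WeightLE μ T M f) (h : T' ≤ T) : WeightLE μ T' M f :=
  fun t ht => hf t ⟨ht.1, ht.2.trans h⟩

theorem congr (hf : WeightLE μ T M f) (h : EqOn g f (Ioc 0 T)) : WeightLE μ T M g :=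
  fun t ht => by rw [h ht]; exact hf t ht

theorem add (hf : WeightLE μ T M f) (hg : WeightLE μ T N g) :
    WeightLE μ T (M + N) (fun t => f t + g t) := fun t ht =>
  (rpow_mul_norm_add_le ht.1.le _ _ _).trans (add_le_add (hf t ht) (hg t ht))

theorem neg (hf : WeightLE μ T M f) : WeightLE μ T M (fun t => -f t) := by
  simpa only [WeightLE, norm_neg] using hf

theorem sub (hf : WeightLE μ T M f) (hg : WeightLE μ T N g) :
    WeightLE μ T (M + N) (fun t => f t - g t) := by
  simpa only [sub_eq_add_neg] using hf.add hg.neg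

theorem clm [NormedSpace ℝ E] [NormedSpace ℝ F] (hf : WeightLE μ T M f) (L : E →L[ℝ] F) :
    WeightLE μ T (‖L‖ * M) (fun t => L (f t)) := fun t ht => by
  have ht0 := ht.1
  calc t ^ (1 - μ) * ‖L (f t)‖ ≤ t ^ (1 - μ) * (‖L‖ * ‖f t‖) := by gcongr; exact L.le_opNorm _
    _ = ‖L‖ * (t ^ (1 - μ) * ‖f t‖) := by ring
    _ ≤ ‖L‖ * M := by gcongr; exact hf t ht

theorem of_forall_half {d : ℝ} (hf : WeightLE μ T N f)
    (h : ∀ M, WeightLE μ T M f → WeightLE μ T ((M + d) / 2) f) : WeightLE μ T d f := by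
  rcases (Ioc 0 T).eq_empty_or_nonempty with hT | ⟨t₀, ht₀⟩
  · exact fun t ht => absurd ht (by rw [hT]; exact notMem_empty t)
  · have : Nonempty (Ioc 0 T) := ⟨⟨t₀, ht₀⟩⟩
    set S := ⨆ t : Ioc 0 T, (t : ℝ) ^ (1 - μ) * ‖f t‖
    have hS : WeightLE μ T S f := fun t ht =>
      le_ciSup (f := fun t : Ioc 0 T => (t : ℝ) ^ (1 - μ) * ‖f t‖)
        ⟨N, by rintro _ ⟨t, rfl⟩; exact hf t t.2⟩ ⟨t, ht⟩
    have hhalf : S ≤ (S + d) / 2 := ciSup_le fun t => h S hS t t.2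
    exact hS.mono (by linarith)

end WeightLE

theorem eqOn_of_weightLE_zero (h : WeightLE μ T 0 (fun t => f t - g t)) : EqOn f g (Ioc 0 T) :=
  fun t ht => sub_eq_zero.1 <| norm_le_zero_iff.1 <|
    nonpos_of_mul_nonpos_right (h t ht) (Real.rpow_pos_of_pos ht.1 _)

theorem MemBC.eventually_weightLE (hf : MemBC μ T f) {ε : ℝ} (hε : 0 < ε) :
    ∀ᶠ δ in 𝓝[>] 0, WeightLE μ δ ε f :=
  eventually_nhdsGT_zero_forall_Ioc (hf.tendsto_zero.eventually (ge_mem_nhds hε))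

theorem memBC_of_tendsto (hf : ContinuousOn f (Ioc 0 T))
    (h : Tendsto (fun t : ℝ => t ^ (1 - μ) * ‖f t‖) (𝓝[>] 0) (𝓝 0)) : MemBC μ T f := by
  refine ⟨hf, ?_, h⟩
  obtain ⟨δ, hδ, hnear⟩ :=
    mem_nhdsGT_iff_exists_Ioc_subset.1 (h.eventually (ge_mem_nhds one_pos))
  have hδ : 0 < δ := hδ
  have hcont : ContinuousOn (fun t : ℝ => t ^ (1 - μ) * ‖f t‖) (Icc δ T) :=
    (continuousOn_id.rpow_const fun t ht => Or.inl (hδ.trans_le ht.1).ne').mul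
      (hf.mono fun t ht => ⟨hδ.trans_le ht.1, ht.2⟩).norm
  obtain ⟨C, hC⟩ := isCompact_Icc.exists_bound_of_continuousOn hcont
  refine ⟨max 1 C, fun t ht => ?_⟩
  rcases le_total t δ with htδ | hδt
  · exact le_max_of_le_left (hnear ⟨ht.1, htδ⟩)
  · exact le_max_of_le_right ((le_abs_self _).trans (hC t ⟨hδt, ht.2⟩))

theorem memBC_of_eventually_le (hf : ContinuousOn f (Ioc 0 T))
    (h : ∀ ε > 0, ∀ᶠ t in 𝓝[>] 0, t ^ (1 - μ) * ‖f t‖ ≤ ε) : MemBC μ T f := by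
  refine memBC_of_tendsto hf ((tendsto_zero_iff_eventually_le ?_).2 h)
  filter_upwards [self_mem_nhdsWithin] with t ht using rpow_mul_norm_nonneg (le_of_lt ht) _ _

theorem memBC_of_continuousOn_Icc (hμ : μ < 1) (hT : 0 < T) (hf : ContinuousOn f (Icc 0 T)) :
    MemBC μ T f := by
  refine memBC_of_tendsto (hf.mono Ioc_subset_Icc_self) ?_
  have hf0 : Tendsto f (𝓝[>] 0) (𝓝 (f 0)) := by
    rw [← nhdsWithin_Ioc_eq_nhdsGT hT]
    exact (hf 0 ⟨le_rfl, hT.le⟩).mono_left (nhdsWithin_mono _ Ioc_subset_Icc_self)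
  simpa using (tendsto_rpow_nhdsGT_zero (sub_pos.2 hμ)).mul hf0.norm

namespace MemBC

theorem mono_right (hf : MemBC μ T f) (h : T' ≤ T) : MemBC μ T' f :=
  ⟨hf.continuousOn.mono (Ioc_subset_Ioc_right h),
    hf.bounded.imp fun _ hC t ht => hC t ⟨ht.1, ht.2.trans h⟩, hf.tendsto_zero⟩

theorem anti_weight (hf : MemBC ν T f) (hμν : μ ≤ ν) : MemBC μ T f := by
  refine memBC_of_eventually_le hf.continuousOn fun ε hε => ?_
  filter_upwards [Ioc_mem_nhdsGT one_pos, hf.tendsto_zero.eventually (ge_mem_nhds hε)]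
    with t ht htε
  simpa using (rpow_mul_norm_le ht hμν (f t)).trans (by simpa using htε)

theorem congr (hf : MemBC μ T f) (hT : 0 < T) (h : EqOn g f (Ioc 0 T)) : MemBC μ T g := by
  refine memBC_of_tendsto (hf.continuousOn.congr h) (hf.tendsto_zero.congr' ?_)
  filter_upwards [Ioc_mem_nhdsGT hT] with t ht
  rw [h ht]

theorem add (hf : MemBC μ T f) (hg : MemBC μ T g) : MemBC μ T (fun t => f t + g t) := by
  refine memBC_of_eventually_le (hf.continuousOn.add hg.continuousOn) fun ε hε => ?_
  filter_upwards [self_mem_nhdsWithin, hf.tendsto_zero.eventually (ge_mem_nhds (half_pos hε)),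
    hg.tendsto_zero.eventually (ge_mem_nhds (half_pos hε))] with t ht hft hgt
  linarith [rpow_mul_norm_add_le (le_of_lt ht) (1 - μ) (f t) (g t)]

theorem neg (hf : MemBC μ T f) : MemBC μ T (fun t => -f t) :=
  ⟨hf.continuousOn.neg, by simpa using hf.bounded, by simpa using hf.tendsto_zero⟩

theorem sub (hf : MemBC μ T f) (hg : MemBC μ T g) : MemBC μ T (fun t => f t - g t) := by
  simpa only [sub_eq_add_neg] using hf.add hg.neg

theorem zero : MemBC μ T (fun _ => (0 : E)) :=
  ⟨continuousOn_const, ⟨0, fun _ _ => by simp⟩, by simp⟩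

theorem shift (hf : MemBC μ T f) (hν : ν < 1) {s : ℝ} (hs : 0 < s) (hsT : s < T) :
    MemBC ν (T - s) (fun t => f (t + s)) :=
  memBC_of_continuousOn_Icc hν (sub_pos.2 hsT) <| hf.continuousOn.comp (by fun_prop)
    fun t ht => ⟨by linarith [ht.1], by linarith [ht.2]⟩

theorem intervalIntegrable (hμ : 0 < μ) (hf : MemBC μ T f) {s t : ℝ} (hs : s ∈ Icc 0 T)
    (ht : t ∈ Icc 0 T) : IntervalIntegrable f volume s t := by
  obtain ⟨C, hC⟩ := hf.bounded
  have hzero : ∀ r ∈ Icc 0 T, IntervalIntegrable f volume 0 r := by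
    intro r hr
    have hdom : IntervalIntegrable (fun s : ℝ => C * s ^ (μ - 1)) volume 0 r :=
      (intervalIntegral.intervalIntegrable_rpow' (by linarith)).const_mul C
    rw [intervalIntegrable_iff_integrableOn_Ioc_of_le hr.1] at hdom ⊢
    refine hdom.mono' ((hf.continuousOn.mono (Ioc_subset_Ioc_right hr.2)).aestronglyMeasurable
      measurableSet_Ioc) ((ae_restrict_iff' measurableSet_Ioc).2 (.of_forall fun s hs => ?_))
    exact norm_le_mul_rpow hs.1 (hC s ⟨hs.1, hs.2.trans hr.2⟩)
  exact (hzero s hs).symm.trans (hzero t ht)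

variable [NormedSpace ℝ E] [NormedSpace ℝ F]

theorem const_smul (hf : MemBC μ T f) (c : ℝ) : MemBC μ T (fun t => c • f t) := by
  refine memBC_of_tendsto (hf.continuousOn.const_smul c) ?_
  simpa [norm_smul, mul_left_comm] using hf.tendsto_zero.const_mul |c|

theorem clm (hf : MemBC μ T f) (L : E →L[ℝ] F) : MemBC μ T (fun t => L (f t)) := by
  refine memBC_of_eventually_le (L.continuous.comp_continuousOn hf.continuousOn) fun ε hε => ?_
  have hlim : Tendsto (fun t : ℝ => ‖L‖ * (t ^ (1 - μ) * ‖f t‖)) (𝓝[>] 0) (𝓝 0) := by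
    simpa using hf.tendsto_zero.const_mul ‖L‖
  filter_upwards [self_mem_nhdsWithin, hlim.eventually (ge_mem_nhds hε)] with t ht htε
  have ht : 0 < t := ht
  calc t ^ (1 - μ) * ‖L (f t)‖ ≤ t ^ (1 - μ) * (‖L‖ * ‖f t‖) := by gcongr; exact L.le_opNorm _
    _ ≤ ε := by rwa [mul_left_comm]

theorem hasDerivWithinAt_integral [CompleteSpace E] (hμ : 0 < μ) (hf : MemBC μ T f) {t : ℝ}
    (ht : t ∈ Ioc 0 T) :
    HasDerivWithinAt (fun r => ∫ s in (0 : ℝ)..r, f s) (f t) (Ioc 0 T) t := by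
  have ht2 : t / 2 < t := half_lt_self ht.1
  have : Fact (t ∈ Icc (t / 2) T) := ⟨⟨ht2.le, ht.2⟩⟩
  have hcont : ContinuousOn f (Icc (t / 2) T) :=
    hf.continuousOn.mono fun s hs => ⟨(half_pos ht.1).trans_le hs.1, hs.2⟩
  have hderiv : HasDerivWithinAt (fun r => ∫ s in (0 : ℝ)..r, f s) (f t) (Icc (t / 2) T) t :=
    intervalIntegral.integral_hasDerivWithinAt_right
      (hf.intervalIntegrable hμ ⟨le_rfl, ht.1.le.trans ht.2⟩ ⟨ht.1.le, ht.2⟩)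
      (hcont.stronglyMeasurableAtFilter_nhdsWithin measurableSet_Icc t) (hcont t this.out)
  refine hderiv.mono_of_mem_nhdsWithin ?_
  filter_upwards [self_mem_nhdsWithin, mem_nhdsWithin_of_mem_nhds (Ioi_mem_nhds ht2)]
    with s hs hs' using ⟨le_of_lt hs', hs.2⟩

end MemBC

theorem WeightLE.norm_integral_le [NormedSpace ℝ E] (hμ : 0 < μ) (hT : 0 ≤ T)
    (hf : WeightLE μ T M f) : ‖∫ s in (0 : ℝ)..T, f s‖ ≤ M * T ^ μ / μ := by
  have hint : IntervalIntegrable (fun s : ℝ => M * s ^ (μ - 1)) volume 0 T :=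
    (intervalIntegral.intervalIntegrable_rpow' (by linarith)).const_mul M
  calc ‖∫ s in (0 : ℝ)..T, f s‖ ≤ ∫ s in (0 : ℝ)..T, M * s ^ (μ - 1) :=
        intervalIntegral.norm_integral_le_of_norm_le hT
          (.of_forall fun s hs => norm_le_mul_rpow hs.1 (hf s hs)) hint
    _ = M * T ^ μ / μ := by
        rw [intervalIntegral.integral_const_mul, integral_rpow (Or.inl (by linarith))]
        simp [Real.zero_rpow hμ.ne', mul_div_assoc]

end Weighted

section Primitive

open MeasureTheory

variable {E₀ E₁ : Type*} [NormedAddCommGroup E₀] [NormedSpace ℝ E₀]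
  [NormedAddCommGroup E₁] [NormedSpace ℝ E₁]

/-- `v ∈ 𝔼_{1,ν}([0,T])` has trace `v(0) = x` and time derivative `g`. The differential relation is
encoded by the integral equation `v(t) = x + ∫₀ᵗ g` in `E₀`, which is stable under limits. -/
structure IsPrimitive (i : E₁ →L[ℝ] E₀) (ν T : ℝ) (x : E₀) (v : ℝ → E₁) (g : ℝ → E₀) : Prop where
  memBC : MemBC ν T v
  memBC_deriv : MemBC ν T g
  integral_eq : ∀ t ∈ Ioc (0 : ℝ) T, i (v t) = x + ∫ s in (0 : ℝ)..t, g s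

variable {i : E₁ →L[ℝ] E₀} {μ ν T T' : ℝ} {x y : E₀} {v w : ℝ → E₁} {g h : ℝ → E₀}

namespace IsPrimitive

theorem mono_right (H : IsPrimitive i ν T x v g) (h : T' ≤ T) : IsPrimitive i ν T' x v g :=
  ⟨H.memBC.mono_right h, H.memBC_deriv.mono_right h,
    fun t ht => H.integral_eq t ⟨ht.1, ht.2.trans h⟩⟩

theorem anti_weight (H : IsPrimitive i ν T x v g) (h : μ ≤ ν) : IsPrimitive i μ T x v g :=
  ⟨H.memBC.anti_weight h, H.memBC_deriv.anti_weight h, H.integral_eq⟩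

theorem congr (H : IsPrimitive i ν T x v g) (hT : 0 < T) (hv : EqOn w v (Ioc 0 T))
    (hg : EqOn h g (Ioc 0 T)) : IsPrimitive i ν T x w h := by
  refine ⟨H.memBC.congr hT hv, H.memBC_deriv.congr hT hg, fun t ht => ?_⟩
  rw [hv ht, H.integral_eq t ht]
  congr 1
  refine intervalIntegral.integral_congr_ae (.of_forall fun s hs => ?_)
  rw [uIoc_of_le ht.1.le] at hs
  exact (hg ⟨hs.1, hs.2.trans ht.2⟩).symm

theorem zero : IsPrimitive i ν T 0 (fun _ => 0) (fun _ => 0) :=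
  ⟨.zero, .zero, fun t _ => by simp⟩

theorem add (hν : 0 < ν) (H : IsPrimitive i ν T x v g) (H' : IsPrimitive i ν T y w h) :
    IsPrimitive i ν T (x + y) (fun t => v t + w t) (fun t => g t + h t) := by
  refine ⟨H.memBC.add H'.memBC, H.memBC_deriv.add H'.memBC_deriv, fun t ht => ?_⟩
  have h0 : (0 : ℝ) ∈ Icc 0 T := ⟨le_rfl, ht.1.le.trans ht.2⟩
  rw [intervalIntegral.integral_add (H.memBC_deriv.intervalIntegrable hν h0 ⟨ht.1.le, ht.2⟩)
    (H'.memBC_deriv.intervalIntegrable hν h0 ⟨ht.1.le, ht.2⟩), map_add, H.integral_eq t ht,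
    H'.integral_eq t ht, add_add_add_comm]

theorem const_smul (H : IsPrimitive i ν T x v g) (c : ℝ) :
    IsPrimitive i ν T (c • x) (fun t => c • v t) (fun t => c • g t) := by
  refine ⟨H.memBC.const_smul c, H.memBC_deriv.const_smul c, fun t ht => ?_⟩
  rw [intervalIntegral.integral_smul, map_smul, H.integral_eq t ht, smul_add]

theorem sub (hν : 0 < ν) (H : IsPrimitive i ν T x v g) (H' : IsPrimitive i ν T y w h) :
    IsPrimitive i ν T (x - y) (fun t => v t - w t) (fun t => g t - h t) := by
  simpa [sub_eq_add_neg] using H.add hν (H'.const_smul (-1))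

theorem shift (hν : 0 < ν) (hμ : μ < 1) (H : IsPrimitive i ν T x v g) {s : ℝ} (hs : 0 < s)
    (hsT : s < T) :
    IsPrimitive i μ (T - s) (i (v s)) (fun t => v (t + s)) (fun t => g (t + s)) := by
  refine ⟨H.memBC.shift hμ hs hsT, H.memBC_deriv.shift hμ hs hsT, fun t ht => ?_⟩
  have hs' : s ∈ Icc 0 T := ⟨hs.le, hsT.le⟩
  have hts : t + s ∈ Ioc 0 T := ⟨add_pos ht.1 hs, le_sub_iff_add_le.1 ht.2⟩
  rw [H.integral_eq (t + s) hts, H.integral_eq s ⟨hs, hsT.le⟩,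
    intervalIntegral.integral_comp_add_right (fun r => g r) s, zero_add, add_assoc,
    intervalIntegral.integral_add_adjacent_intervals
      (H.memBC_deriv.intervalIntegrable hν ⟨le_rfl, hs'.1.trans hs'.2⟩ hs')
      (H.memBC_deriv.intervalIntegrable hν hs' (Ioc_subset_Icc_self hts))]

theorem norm_sub_le (hν : 0 < ν) (H : IsPrimitive i ν T x v g) {t M : ℝ} (ht : t ∈ Ioc 0 T)
    (hg : WeightLE ν t M g) : ‖i (v t) - x‖ ≤ M * t ^ ν / ν := by
  rw [H.integral_eq t ht, add_sub_cancel_left]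
  exact hg.norm_integral_le hν ht.1.le

theorem hasTrace (hν : 0 < ν) (hT : 0 < T) (H : IsPrimitive i ν T x v g) : HasTrace i v x := by
  obtain ⟨C, hC⟩ := H.memBC_deriv.bounded
  have hlim : Tendsto (fun t : ℝ => C * t ^ ν / ν) (𝓝[>] 0) (𝓝 0) := by
    simpa using ((tendsto_rpow_nhdsGT_zero hν).const_mul C).div_const ν
  refine tendsto_iff_norm_sub_tendsto_zero.2 (squeeze_zero' (.of_forall fun t => norm_nonneg _) ?_
    hlim)
  filter_upwards [Ioc_mem_nhdsGT hT] with t ht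
  exact H.norm_sub_le hν ht fun s hs => hC s ⟨hs.1, hs.2.trans ht.2⟩

variable [CompleteSpace E₀]

theorem hasDerivWithinAt (hν : 0 < ν) (H : IsPrimitive i ν T x v g) {t : ℝ}
    (ht : t ∈ Ioc 0 T) : HasDerivWithinAt (fun s => i (v s)) (g t) (Ioc 0 T) t :=
  ((H.memBC_deriv.hasDerivWithinAt_integral hν ht).const_add x).congr H.integral_eq
    (H.integral_eq t ht)

theorem timeDeriv_eq (hν : 0 < ν) (H : IsPrimitive i ν T x v g) :
    EqOn (timeDeriv i T v) g (Ioc 0 T) := fun t ht =>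
  (H.hasDerivWithinAt hν ht).derivWithin (uniqueDiffOn_Ioc 0 T t ht)

theorem memE1 (hν : 0 < ν) (hT : 0 < T) (H : IsPrimitive i ν T x v g) : MemE1 i ν T v :=
  ⟨fun _ ht => (H.hasDerivWithinAt hν ht).differentiableWithinAt, H.memBC.clm i,
    H.memBC_deriv.congr hT (H.timeDeriv_eq hν), H.memBC⟩

theorem of_hasDerivWithinAt (hν : 0 < ν) (hv : MemBC ν T v) (hg : MemBC ν T g)
    (hderiv : ∀ s ∈ Ioc 0 T, HasDerivWithinAt (fun s => i (v s)) (g s) (Ioc 0 T) s)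
    (hx : HasTrace i v x) : IsPrimitive i ν T x v g := by
  refine ⟨hv, hg, fun t ht => ?_⟩
  have hend : Tendsto (fun s => i (v s)) (𝓝[<] t) (𝓝 (i (v t))) := by
    rw [← nhdsWithin_Ioo_eq_nhdsLT ht.1]
    exact (hderiv t ht).continuousWithinAt.tendsto.mono_left
      (nhdsWithin_mono _ fun s hs => ⟨hs.1, hs.2.le.trans ht.2⟩)
  have hFTC := intervalIntegral.integral_eq_sub_of_hasDerivAt_of_tendsto ht.1
    (fun s hs => (hderiv s ⟨hs.1, hs.2.le.trans ht.2⟩).hasDerivAt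
      (Ioc_mem_nhds hs.1 (hs.2.trans_le ht.2)))
    (hg.intervalIntegrable hν ⟨le_rfl, ht.1.le.trans ht.2⟩ ⟨ht.1.le, ht.2⟩) hx hend
  rw [hFTC, add_sub_cancel]

end IsPrimitive

theorem MemE1.isPrimitive [CompleteSpace E₀] (hν : 0 < ν) (H : MemE1 i ν T v)
    (hx : HasTrace i v x) : IsPrimitive i ν T x v (timeDeriv i T v) :=
  .of_hasDerivWithinAt hν H.memBC_one H.memBC_deriv
    (fun s hs => (H.differentiableOn s hs).hasDerivWithinAt) hx

end Primitive

section Trace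

variable {E₀ E₁ : Type*} [NormedAddCommGroup E₀] [NormedSpace ℝ E₀]
  [NormedAddCommGroup E₁] [NormedSpace ℝ E₁]
  {i : E₁ →L[ℝ] E₀} {ν T t M : ℝ} {x : E₀} {v : ℝ → E₁} {g : ℝ → E₀}

theorem mul_norm_le_of_rpow_mul_norm_le {E : Type*} [NormedAddCommGroup E] (ht : 0 < t) {a : E}
    (h : t ^ (1 - ν) * ‖a‖ ≤ M) : t * ‖a‖ ≤ t ^ ν * M := by
  calc t * ‖a‖ = t ^ ν * (t ^ (1 - ν) * ‖a‖) := by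
        rw [← mul_assoc, ← Real.rpow_add ht, add_sub_cancel, Real.rpow_one]
    _ ≤ t ^ ν * M := by gcongr

namespace IsPrimitive

theorem kFun_le (hν : 0 < ν) (H : IsPrimitive i ν T x v g) (ht : t ∈ Ioc 0 T)
    (hv : WeightLE ν t M v) (hg : WeightLE ν t M g) :
    kFun i t x ≤ t ^ ν * ((1 / ν + 1) * M) := by
  calc kFun i t x ≤ ‖x - i (v t)‖ + t * ‖v t‖ := ContMaxReg.kFun_le i ht.1.le x (v t)
    _ ≤ M * t ^ ν / ν + t ^ ν * M := by
        rw [norm_sub_rev]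
        exact add_le_add (H.norm_sub_le hν ht hg)
          (mul_norm_le_of_rpow_mul_norm_le ht.1 (hv t ⟨ht.1, le_rfl⟩))
    _ = t ^ ν * ((1 / ν + 1) * M) := by ring

theorem mem_interpSpace (hν : 0 < ν) (hT : 0 < T) (H : IsPrimitive i ν T x v g) :
    x ∈ interpSpace i ν := by
  refine mem_interpSpace_iff.2 fun ε hε => ?_
  have hη : 0 < ε / (1 / ν + 1) := by positivity
  filter_upwards [Ioc_mem_nhdsGT hT, H.memBC.eventually_weightLE hη,
    H.memBC_deriv.eventually_weightLE hη] with t ht hvt hgt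
  refine (H.kFun_le hν ht hvt hgt).trans_eq ?_
  field_simp

theorem interpNorm_sub_le (hν : 0 < ν) (hν1 : ν < 1) (H : IsPrimitive i ν T x v g)
    (ht : t ∈ Ioc 0 T) (hv : WeightLE ν t M v) (hg : WeightLE ν t M g) :
    interpNorm i ν (i (v t) - x) ≤ (1 / ν + 2) * M := by
  have hM : 0 ≤ M := hv.nonneg ht.1
  refine interpNorm_le fun s hs => ?_
  rcases le_total t s with hts | hst
  · have ht0 := ht.1
    calc kFun i s (i (v t) - x) ≤ ‖i (v t) - x‖ := kFun_le_norm i hs.le _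
      _ ≤ M * t ^ ν / ν := H.norm_sub_le hν ht hg
      _ ≤ M * s ^ ν / ν + 2 * (M * s ^ ν) := le_add_of_le_of_nonneg (by gcongr) (by positivity)
      _ = s ^ ν * ((1 / ν + 2) * M) := by ring
  · have hvt : s * ‖v t‖ ≤ s ^ ν * M := by
      refine mul_norm_le_of_rpow_mul_norm_le hs (le_trans ?_ (hv t ⟨ht.1, le_rfl⟩))
      gcongr
    calc kFun i s (i (v t) - x) ≤ kFun i s (i (v t)) + kFun i s x := by
          simpa only [sub_eq_add_neg, kFun_neg] using kFun_add_le i hs.le (i (v t)) (-x)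
      _ ≤ s ^ ν * M + s ^ ν * ((1 / ν + 1) * M) := add_le_add
          ((kFun_apply_le i hs.le _).trans hvt)
          (H.kFun_le hν ⟨hs, hst.trans ht.2⟩ (hv.mono_right hst) (hg.mono_right hst))
      _ = s ^ ν * ((1 / ν + 2) * M) := by ring

theorem tendsto_interpNorm_sub (hν : 0 < ν) (hν1 : ν < 1) (hT : 0 < T)
    (H : IsPrimitive i ν T x v g) :
    Tendsto (fun t => interpNorm i ν (i (v t) - x)) (𝓝[>] 0) (𝓝 0) := by
  refine (tendsto_zero_iff_eventually_le (.of_forall fun _ => interpNorm_nonneg _ _ _)).2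
    fun ε hε => ?_
  have hη : 0 < ε / (1 / ν + 2) := by positivity
  filter_upwards [Ioc_mem_nhdsGT hT, H.memBC.eventually_weightLE hη,
    H.memBC_deriv.eventually_weightLE hη] with t ht hvt hgt
  refine (H.interpNorm_sub_le hν hν1 ht hvt hgt).trans_eq ?_
  field_simp

end IsPrimitive

end Trace

section DyadicMean

open MeasureTheory

variable {E F : Type*} [NormedAddCommGroup E] [NormedAddCommGroup F] {f : ℝ → E} {t C : ℝ}

theorem intervalIntegrable_of_continuousOn_Ioi (hf : ContinuousOn f (Ioi 0)) {r s : ℝ}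
    (hr : 0 < r) (hs : 0 < s) : IntervalIntegrable f volume r s :=
  (hf.mono fun _ hu => (lt_min hr hs).trans_le hu.1).intervalIntegrable

variable [NormedSpace ℝ E] [NormedSpace ℝ F]

/-- The mean `t⁻¹ ∫_t^{2t} f` of `f` over `[t, 2t]`, used to regularize a continuous choice of
almost optimal decompositions in the `K`-functional. -/
noncomputable def dyadicMean (f : ℝ → E) (t : ℝ) : E := t⁻¹ • ∫ s in t..2 * t, f s

/-- The derivative of `dyadicMean f` for `t > 0`. -/
noncomputable def dyadicMeanDeriv (f : ℝ → E) (t : ℝ) : E :=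
  t⁻¹ • ((2 : ℝ) • f (2 * t) - f t - dyadicMean f t)

theorem dyadicMean_const [CompleteSpace E] (ht : 0 < t) (x : E) :
    dyadicMean (fun _ => x) t = x := by
  rw [dyadicMean, intervalIntegral.integral_const, two_mul, add_sub_cancel_right, smul_smul,
    inv_mul_cancel₀ ht.ne', one_smul]

theorem dyadicMean_sub {g : ℝ → E} (hf : ContinuousOn f (Ioi 0)) (hg : ContinuousOn g (Ioi 0))
    (ht : 0 < t) : dyadicMean (fun s => f s - g s) t = dyadicMean f t - dyadicMean g t := by
  have h2t : 0 < 2 * t := by positivity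
  rw [dyadicMean, intervalIntegral.integral_sub (intervalIntegrable_of_continuousOn_Ioi hf ht h2t)
    (intervalIntegrable_of_continuousOn_Ioi hg ht h2t), smul_sub]
  rfl

theorem clm_dyadicMean [CompleteSpace E] [CompleteSpace F] (L : E →L[ℝ] F)
    (hf : ContinuousOn f (Ioi 0)) (ht : 0 < t) :
    L (dyadicMean f t) = dyadicMean (fun s => L (f s)) t := by
  rw [dyadicMean, map_smul, dyadicMean, L.intervalIntegral_comp_comm
    (intervalIntegrable_of_continuousOn_Ioi hf ht (by positivity))]

theorem norm_dyadicMean_le (ht : 0 < t) (hf : ∀ s ∈ Icc t (2 * t), ‖f s‖ ≤ C) :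
    ‖dyadicMean f t‖ ≤ C := by
  have ht2 : t ≤ 2 * t := by linarith
  have hint : ‖∫ s in t..2 * t, f s‖ ≤ C * |2 * t - t| :=
    intervalIntegral.norm_integral_le_of_norm_le_const fun s hs => by
      rw [uIoc_of_le ht2] at hs
      exact hf s (Ioc_subset_Icc_self hs)
  rw [dyadicMean, norm_smul, norm_inv, Real.norm_of_nonneg ht.le, inv_mul_le_iff₀ ht]
  rwa [two_mul t, add_sub_cancel_right, abs_of_pos ht, mul_comm C, ← two_mul] at hint

theorem mul_norm_dyadicMeanDeriv_le (ht : 0 < t) (hf : ∀ s ∈ Icc t (2 * t), ‖f s‖ ≤ C) :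
    t * ‖dyadicMeanDeriv f t‖ ≤ 4 * C := by
  have ht2 : t ≤ 2 * t := by linarith
  rw [dyadicMeanDeriv, norm_smul, norm_inv, Real.norm_of_nonneg ht.le, mul_inv_cancel_left₀ ht.ne']
  calc ‖(2 : ℝ) • f (2 * t) - f t - dyadicMean f t‖
      ≤ ‖(2 : ℝ) • f (2 * t)‖ + ‖f t‖ + ‖dyadicMean f t‖ :=
        (norm_sub_le _ _).trans (by gcongr; exact norm_sub_le _ _)
    _ ≤ 2 * C + C + C := by
        rw [norm_smul, Real.norm_two]
        gcongr
        exacts [hf _ ⟨ht2, le_rfl⟩, hf _ ⟨le_rfl, ht2⟩, norm_dyadicMean_le ht hf]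
    _ = 4 * C := by ring

variable [CompleteSpace E]

theorem hasDerivAt_dyadicMean (hf : ContinuousOn f (Ioi 0)) (ht : 0 < t) :
    HasDerivAt (dyadicMean f) (dyadicMeanDeriv f t) t := by
  have hint : ∀ r > 0, IntervalIntegrable f volume 1 r := fun r hr =>
    intervalIntegrable_of_continuousOn_Ioi hf one_pos hr
  have hprim : ∀ r > 0, HasDerivAt (fun r => ∫ s in (1 : ℝ)..r, f s) (f r) r := fun r hr =>
    intervalIntegral.integral_hasDerivAt_right (hint r hr)
      (hf.stronglyMeasurableAtFilter isOpen_Ioi r hr) (hf.continuousAt (Ioi_mem_nhds hr))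
  have hmean : ∀ r > 0, dyadicMean f r =
      r⁻¹ • ((∫ s in (1 : ℝ)..2 * r, f s) - ∫ s in (1 : ℝ)..r, f s) := fun r hr => by
    rw [dyadicMean, intervalIntegral.integral_interval_sub_left (hint (2 * r) (by positivity))
      (hint r hr)]
  have htwo : HasDerivAt (fun r : ℝ => ∫ s in (1 : ℝ)..2 * r, f s) ((2 : ℝ) • f (2 * t)) t := by
    have hmul : HasDerivAt (fun r : ℝ => 2 * r) 2 t := by
      simpa using (hasDerivAt_id t).const_mul 2
    exact (hprim (2 * t) (by positivity)).scomp t hmul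
  refine (((hasDerivAt_inv ht.ne').smul (htwo.sub (hprim t ht))).congr_of_eventuallyEq
    ?_).congr_deriv ?_
  · filter_upwards [Ioi_mem_nhds ht] with r hr using hmean r hr
  · rw [dyadicMeanDeriv, hmean t ht, Pi.sub_apply]
    module

theorem continuousOn_dyadicMean (hf : ContinuousOn f (Ioi 0)) :
    ContinuousOn (dyadicMean f) (Ioi 0) :=
  fun _ ht => (hasDerivAt_dyadicMean hf ht).continuousAt.continuousWithinAt

theorem continuousOn_dyadicMeanDeriv (hf : ContinuousOn f (Ioi 0)) :
    ContinuousOn (dyadicMeanDeriv f) (Ioi 0) := by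
  have hdouble : ContinuousOn (fun t => f (2 * t)) (Ioi 0) :=
    hf.comp (by fun_prop) fun t ht => mul_pos two_pos (mem_Ioi.1 ht)
  exact (continuousOn_inv₀.mono fun t ht => ne_of_gt ht).smul
    (((hdouble.const_smul (2 : ℝ)).sub hf).sub (continuousOn_dyadicMean hf))

end DyadicMean

section Extension

variable {E₀ E₁ : Type*} [NormedAddCommGroup E₀] [NormedSpace ℝ E₀]
  [NormedAddCommGroup E₁] [NormedSpace ℝ E₁] (i : E₁ →L[ℝ] E₀)

theorem convexOn_norm_sub_add_mul_norm {t : ℝ} (ht : 0 ≤ t) (x : E₀) :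
    ConvexOn ℝ univ fun b : E₁ => ‖x - i b‖ + t * ‖b‖ := by
  have hdist : ConvexOn ℝ univ fun y : E₀ => ‖x - y‖ := by
    simpa [dist_eq_norm, norm_sub_rev] using convexOn_univ_dist (E := E₀) x
  exact (hdist.comp_linearMap i.toLinearMap).add ((convexOn_univ_norm (E := E₁)).smul ht)

theorem exists_eventually_lt_three_mul_kFun {x : E₀} (hx : x ≠ 0) {t : ℝ} (ht : 0 < t) :
    ∃ b : E₁, ∀ᶠ s in 𝓝 t, ‖x - i b‖ + s * ‖b‖ < 3 * kFun i s x := by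
  have hK := kFun_pos i ht hx
  obtain ⟨b, hb⟩ := exists_lt_of_kFun_lt i (show kFun i t x < 2 * kFun i t x by linarith)
  have hcont : Continuous fun s : ℝ => ‖x - i b‖ + s * ‖b‖ := by fun_prop
  refine ⟨b, ?_⟩
  filter_upwards [hcont.continuousAt.eventually (gt_mem_nhds hb),
    lt_mem_nhds (show 2 / 3 * t < t by linarith)] with s hsb hts
  have hs : 0 < s := by linarith
  refine hsb.trans_le ?_
  rcases le_total s t with hst | hts'
  · have hratio : t / s ≤ 3 / 2 := by rw [div_le_iff₀ hs]; linarith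
    linarith [kFun_le_div_mul i hs hst x,
      mul_le_mul_of_nonneg_right hratio (kFun_nonneg i hs.le x)]
  · linarith [kFun_mono i ht.le hts' x]

theorem exists_continuousOn_lt_three_mul_kFun {x : E₀} (hx : x ≠ 0) :
    ∃ b : ℝ → E₁, ContinuousOn b (Ioi 0) ∧
      ∀ t > 0, ‖x - i (b t)‖ + t * ‖b t‖ < 3 * kFun i t x := by
  obtain ⟨g, hg⟩ := exists_continuous_forall_mem_convex_of_local_const
    (X := Ioi (0 : ℝ)) (t := fun t => {b : E₁ | ‖x - i b‖ + t * ‖b‖ < 3 * kFun i t x})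
    (fun t => by
      simpa using (convexOn_norm_sub_add_mul_norm i (le_of_lt t.2) x).convex_lt (3 * kFun i t x))
    (fun t => (exists_eventually_lt_three_mul_kFun i hx t.2).imp fun b hb =>
      continuous_subtype_val.continuousAt.eventually hb)
  refine ⟨Function.extend Subtype.val g 0, ?_, fun t ht => ?_⟩
  · rw [continuousOn_iff_continuous_domRestrict]
    exact g.continuous.congr fun t => (Subtype.val_injective.extend_apply g 0 t).symm
  · rw [show Function.extend Subtype.val g 0 t = g ⟨t, ht⟩ from
      Subtype.val_injective.extend_apply g 0 ⟨t, ht⟩]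
    exact hg ⟨t, ht⟩

variable {i} {ν C : ℝ} {x : E₀}

theorem rpow_one_sub_mul_le {t a M : ℝ} (ht : 0 < t) (h : t * a ≤ t ^ ν * M) :
    t ^ (1 - ν) * a ≤ M := by
  rwa [sub_eq_neg_add, Real.rpow_add ht, Real.rpow_one, mul_assoc, rpow_neg_mul_le_iff ht]

theorem tendsto_kFun_nhdsGT_zero (hν : 0 < ν) (hx : x ∈ interpSpace i ν) :
    Tendsto (fun t => kFun i t x) (𝓝[>] 0) (𝓝 0) := by
  have hx : Tendsto (fun t : ℝ => t ^ (-ν) * kFun i t x) (𝓝[>] 0) (𝓝 0) := hx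
  have hlim := (tendsto_rpow_nhdsGT_zero hν).mul hx
  rw [mul_zero] at hlim
  refine hlim.congr' ?_
  filter_upwards [self_mem_nhdsWithin] with t ht
  rw [← mul_assoc, ← Real.rpow_add ht, add_neg_cancel, Real.rpow_zero, one_mul]

section

variable {E : Type*} [NormedAddCommGroup E] {f : ℝ → E}

theorem memBC_of_mul_norm_le_kFun (hC : 0 < C) (hx : x ∈ interpSpace i ν)
    (hf : ContinuousOn f (Ioi 0)) (hfK : ∀ t > 0, t * ‖f t‖ ≤ C * kFun i t x) (T : ℝ) :
    MemBC ν T f := by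
  refine memBC_of_eventually_le (hf.mono Ioc_subset_Ioi_self) fun ε hε => ?_
  filter_upwards [self_mem_nhdsWithin, mem_interpSpace_iff.1 hx (ε / C) (div_pos hε hC)]
    with t ht hK
  refine rpow_one_sub_mul_le ht ((hfK t ht).trans ?_)
  rwa [← le_div_iff₀' hC, mul_div_assoc]

theorem weightLE_of_mul_norm_le_kFun (hν : 0 ≤ ν) (hC : 0 ≤ C) (hx : x ∈ interpSpace i ν)
    (hfK : ∀ t > 0, t * ‖f t‖ ≤ C * kFun i t x) (T : ℝ) :
    WeightLE ν T (C * interpNorm i ν x) f := fun t ht => by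
  refine rpow_one_sub_mul_le ht.1 ((hfK t ht.1).trans ?_)
  rw [mul_left_comm]
  gcongr
  exact kFun_le_interpNorm hν hx ht.1

end

variable [CompleteSpace E₀] [CompleteSpace E₁]

theorem exists_isPrimitive_of_mem_interpSpace (hν : 0 < ν) (hx : x ∈ interpSpace i ν) (T : ℝ) :
    ∃ (v : ℝ → E₁) (g : ℝ → E₀), IsPrimitive i ν T x v g ∧
      WeightLE ν T (24 * interpNorm i ν x) v ∧ WeightLE ν T (24 * interpNorm i ν x) g := by
  rcases eq_or_ne x 0 with rfl | hx0
  · exact ⟨fun _ => 0, fun _ => 0, .zero, fun t _ => by simp [interpNorm_zero],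
      fun t _ => by simp [interpNorm_zero]⟩
  obtain ⟨b, hb, hbK⟩ := exists_continuousOn_lt_three_mul_kFun i hx0
  set c : ℝ → E₀ := fun s => i (b s) - x
  have hib : ContinuousOn (fun s => i (b s)) (Ioi 0) := i.continuous.comp_continuousOn hb
  have hc : ContinuousOn c (Ioi 0) := hib.sub continuousOn_const
  have hb_le : ∀ t > 0, ∀ s ∈ Icc t (2 * t), ‖b s‖ ≤ 6 * kFun i t x / t := fun t ht s hs => by
    rw [le_div_iff₀' ht]
    linarith [hbK s (ht.trans_le hs.1), norm_nonneg (x - i (b s)),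
      kFun_le_two_mul i ht hs x, mul_le_mul_of_nonneg_right hs.1 (norm_nonneg (b s))]
  have hc_le : ∀ t > 0, ∀ s ∈ Icc t (2 * t), ‖c s‖ ≤ 6 * kFun i t x := fun t ht s hs => by
    have hs0 := ht.trans_le hs.1
    rw [norm_sub_rev]
    linarith [hbK s hs0, mul_nonneg hs0.le (norm_nonneg (b s)), kFun_le_two_mul i ht hs x]
  have hv_le : ∀ t > 0, t * ‖dyadicMean b t‖ ≤ 24 * kFun i t x := fun t ht => by
    have hmean := (le_div_iff₀' ht).1 (norm_dyadicMean_le ht (hb_le t ht))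
    linarith [kFun_nonneg i ht.le x]
  have hg_le : ∀ t > 0, t * ‖dyadicMeanDeriv c t‖ ≤ 24 * kFun i t x := fun t ht =>
    (mul_norm_dyadicMeanDeriv_le ht (hc_le t ht)).trans_eq (by ring)
  have hiv : ∀ t > 0, i (dyadicMean b t) = x + dyadicMean c t := fun t ht => by
    rw [clm_dyadicMean i hb ht, dyadicMean_sub hib continuousOn_const ht, dyadicMean_const ht,
      add_sub_cancel]
  have htrace : HasTrace i (dyadicMean b) x := by
    have hlim : Tendsto (fun t => 6 * kFun i t x) (𝓝[>] 0) (𝓝 0) := by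
      simpa using (tendsto_kFun_nhdsGT_zero hν hx).const_mul 6
    refine tendsto_iff_norm_sub_tendsto_zero.2
      (squeeze_zero' (.of_forall fun t => norm_nonneg _) ?_ hlim)
    filter_upwards [self_mem_nhdsWithin] with t ht
    rw [hiv t ht, add_sub_cancel_left]
    exact norm_dyadicMean_le ht (hc_le t ht)
  refine ⟨dyadicMean b, dyadicMeanDeriv c, .of_hasDerivWithinAt hν
    (memBC_of_mul_norm_le_kFun (by norm_num) hx (continuousOn_dyadicMean hb) hv_le T)
    (memBC_of_mul_norm_le_kFun (by norm_num) hx (continuousOn_dyadicMeanDeriv hc) hg_le T)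
    (fun t ht => ?_) htrace,
    weightLE_of_mul_norm_le_kFun hν.le (by norm_num) hx hv_le T,
    weightLE_of_mul_norm_le_kFun hν.le (by norm_num) hx hg_le T⟩
  refine (((hasDerivAt_dyadicMean hc ht.1).const_add x).congr_of_eventuallyEq ?_).hasDerivWithinAt
  filter_upwards [Ioi_mem_nhds ht.1] with s hs using hiv s hs

end Extension

section WeightedSpace

open scoped ZeroAtInfty

theorem map_val_cocompact_Ioc {T : ℝ} (hT : 0 < T) :
    map Subtype.val (cocompact (Ioc (0 : ℝ) T)) = 𝓝[>] 0 := by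
  ext s
  rw [mem_map, mem_cocompact]
  constructor
  · rintro ⟨K, hK, hKs⟩
    have hclosed : IsClosed (Subtype.val '' K) := (hK.image continuous_subtype_val).isClosed
    have hzero : (0 : ℝ) ∉ Subtype.val '' K := fun ⟨t, _, ht⟩ => t.2.1.ne' ht
    filter_upwards [Ioc_mem_nhdsGT hT, mem_nhdsWithin_of_mem_nhds (hclosed.compl_mem_nhds hzero)]
      with t ht htK
    exact hKs fun h : (⟨t, ht⟩ : Ioc 0 T) ∈ K => htK ⟨_, h, rfl⟩
  · intro hs
    obtain ⟨δ, hδ, hδs⟩ := mem_nhdsGT_iff_exists_Ioc_subset.1 hs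
    have hcompact : IsCompact (Subtype.val ⁻¹' Icc δ T : Set (Ioc (0 : ℝ) T)) :=
      IsInducing.subtypeVal.isCompact_preimage' isCompact_Icc
        (by rw [Subtype.range_val]; exact fun t ht => ⟨(mem_Ioi.1 hδ).trans_le ht.1, ht.2⟩)
    refine ⟨_, hcompact, fun t ht => hδs ⟨t.2.1, ?_⟩⟩
    exact (not_le.1 fun h => ht ⟨h, t.2.2⟩).le

variable {E : Type*} [NormedAddCommGroup E] [NormedSpace ℝ E] {μ T M t : ℝ}

theorem rpow_mul_norm_rpow_smul (ht : 0 < t) (a : E) : t ^ (1 - μ) * ‖t ^ (μ - 1) • a‖ = ‖a‖ := by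
  rw [norm_smul, Real.norm_of_nonneg (Real.rpow_nonneg ht.le _), ← mul_assoc, ← Real.rpow_add ht]
  simp

theorem rpow_smul_rpow_smul (ht : 0 < t) (a : E) : t ^ (μ - 1) • t ^ (1 - μ) • a = a := by
  rw [smul_smul, ← Real.rpow_add ht]
  simp

/-- The isometry `g ↦ t^{μ-1} g(t)` of the Banach space `C₀((0,T], E)` of continuous functions that
vanish at `0` onto `BC_{1-μ}([0,T], E)`; the values off `(0,T]` are set to `0`. -/
noncomputable def unweight (μ : ℝ) : C₀(Ioc (0 : ℝ) T, E) →ₗ[ℝ] ℝ → E where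
  toFun g t := if h : t ∈ Ioc 0 T then t ^ (μ - 1) • g ⟨t, h⟩ else 0
  map_add' f g := by
    ext t
    by_cases h : t ∈ Ioc 0 T <;> simp [h, -mem_Ioc]
  map_smul' c g := by
    ext t
    by_cases h : t ∈ Ioc 0 T <;> simp [h, -mem_Ioc, smul_comm c]

theorem unweight_apply (g : C₀(Ioc (0 : ℝ) T, E)) (ht : t ∈ Ioc 0 T) :
    unweight μ g t = t ^ (μ - 1) • g ⟨t, ht⟩ := dif_pos ht

theorem rpow_mul_norm_unweight (g : C₀(Ioc (0 : ℝ) T, E)) (ht : t ∈ Ioc 0 T) :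
    t ^ (1 - μ) * ‖unweight μ g t‖ = ‖g ⟨t, ht⟩‖ := by
  rw [unweight_apply g ht, rpow_mul_norm_rpow_smul ht.1]

theorem weightLE_unweight (g : C₀(Ioc (0 : ℝ) T, E)) : WeightLE μ T ‖g‖ (unweight μ g) :=
  fun t ht => by
    rw [rpow_mul_norm_unweight g ht]
    exact g.toBCF.norm_coe_le_norm ⟨t, ht⟩

theorem norm_le_of_weightLE_unweight {g : C₀(Ioc (0 : ℝ) T, E)} (hM : 0 ≤ M)
    (h : WeightLE μ T M (unweight μ g)) : ‖g‖ ≤ M :=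
  (BoundedContinuousFunction.norm_le (f := g.toBCF) hM).2 fun t =>
    (rpow_mul_norm_unweight g t.2).symm.trans_le (h t t.2)

theorem eq_of_eqOn_unweight {f g : C₀(Ioc (0 : ℝ) T, E)}
    (h : EqOn (unweight μ f) (unweight μ g) (Ioc 0 T)) : f = g := by
  refine sub_eq_zero.1 (norm_le_zero_iff.1 (norm_le_of_weightLE_unweight (μ := μ) le_rfl ?_))
  intro t ht
  rw [map_sub, Pi.sub_apply, h ht]
  simp

theorem memBC_unweight (hT : 0 < T) (g : C₀(Ioc (0 : ℝ) T, E)) : MemBC μ T (unweight μ g) := by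
  refine memBC_of_tendsto ?_ ?_
  · rw [continuousOn_iff_continuous_domRestrict]
    have hcont : Continuous fun t : Ioc (0 : ℝ) T => (t : ℝ) ^ (μ - 1) • g t :=
      (continuous_subtype_val.rpow_const fun t => Or.inl t.2.1.ne').smul g.continuous
    exact hcont.congr fun t => (unweight_apply g t.2).symm
  · rw [← map_val_cocompact_Ioc hT, tendsto_map'_iff]
    refine (tendsto_zero_iff_norm_tendsto_zero.1 g.zero_at_infty').congr fun t => ?_
    exact (rpow_mul_norm_unweight g t.2).symm

theorem MemBC.exists_unweight_eqOn (hT : 0 < T) {f : ℝ → E} (hf : MemBC μ T f) :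
    ∃ g : C₀(Ioc (0 : ℝ) T, E), EqOn (unweight μ g) f (Ioc 0 T) := by
  have hcont : Continuous fun t : Ioc (0 : ℝ) T => (t : ℝ) ^ (1 - μ) • f t :=
    (continuous_subtype_val.rpow_const fun t => Or.inl t.2.1.ne').smul
      (continuousOn_iff_continuous_domRestrict.1 hf.continuousOn)
  have hzero : Tendsto (fun t : Ioc (0 : ℝ) T => (t : ℝ) ^ (1 - μ) • f t) (cocompact _) (𝓝 0) := by
    have hlim := hf.tendsto_zero
    rw [← map_val_cocompact_Ioc hT, tendsto_map'_iff] at hlim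
    refine tendsto_zero_iff_norm_tendsto_zero.2 (hlim.congr fun t => ?_)
    rw [norm_smul, Real.norm_of_nonneg (Real.rpow_nonneg t.2.1.le _)]
    rfl
  refine ⟨⟨⟨_, hcont⟩, hzero⟩, fun t ht => ?_⟩
  rw [unweight_apply _ ht]
  exact rpow_smul_rpow_smul ht.1 (f t)

theorem MemBC.exists_extend {f : ℝ → E} {δ : ℝ} (hδ : 0 < δ) (hf : MemBC μ δ f) (T : ℝ) :
    ∃ g : ℝ → E, EqOn g f (Ioc 0 δ) ∧ MemBC μ T g ∧ ∀ M, WeightLE μ δ M f → WeightLE μ T M g := by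
  set g : ℝ → E := fun t => t ^ (μ - 1) • (min t δ) ^ (1 - μ) • f (min t δ) with hg
  have hmaps : MapsTo (fun t : ℝ => min t δ) (Ioc 0 T) (Ioc 0 δ) := fun t ht =>
    ⟨lt_min ht.1 hδ, min_le_right _ _⟩
  have hweight : ∀ t > 0, t ^ (1 - μ) * ‖g t‖ = (min t δ) ^ (1 - μ) * ‖f (min t δ)‖ :=
    fun t ht => by
      rw [hg, rpow_mul_norm_rpow_smul ht, norm_smul,
        Real.norm_of_nonneg (Real.rpow_nonneg (lt_min ht hδ).le _)]
  have hgf : EqOn g f (Ioc 0 δ) := fun t ht => by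
    simp only [hg, min_eq_left ht.2]
    exact rpow_smul_rpow_smul ht.1 (f t)
  refine ⟨g, hgf, memBC_of_tendsto ?_ (hf.tendsto_zero.congr' ?_), fun M hM t ht => ?_⟩
  · have hmin : ContinuousOn (fun t : ℝ => min t δ) (Ioc 0 T) := by fun_prop
    exact (continuousOn_id.rpow_const fun t ht => Or.inl ht.1.ne').smul
      ((hmin.rpow_const fun t ht => Or.inl (hmaps ht).1.ne').smul (hf.continuousOn.comp hmin hmaps))
  · filter_upwards [Ioc_mem_nhdsGT hδ] with t ht
    rw [hgf ht]
  · rw [hweight t ht.1]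
    exact hM _ (hmaps ht)

theorem exists_eqOn_of_contraction [CompleteSpace E] {ε : ℝ} (hT : 0 < T) (hε : 0 ≤ ε)
    {Φ : (ℝ → E) → ℝ → E}
    (hmaps : ∀ f, MemBC μ T f → WeightLE μ T ε f → MemBC μ T (Φ f) ∧ WeightLE μ T ε (Φ f))
    (hcontr : ∀ f g, MemBC μ T f → WeightLE μ T ε f → MemBC μ T g → WeightLE μ T ε g →
      ∀ M, WeightLE μ T M (fun t => f t - g t) →
        WeightLE μ T (M / 2) (fun t => Φ f t - Φ g t)) :
    ∃ f, MemBC μ T f ∧ WeightLE μ T ε f ∧ EqOn (Φ f) f (Ioc 0 T) := by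
  set S := Metric.closedBall (0 : C₀(Ioc (0 : ℝ) T, E)) ε
  have hbound : ∀ g : S, WeightLE μ T ε (unweight μ g.1) := fun g =>
    (weightLE_unweight g.1).mono (mem_closedBall_zero_iff.1 g.2)
  choose Ψ hΨ using fun g : S =>
    (hmaps _ (memBC_unweight hT g.1) (hbound g)).1.exists_unweight_eqOn hT
  have hΨS : ∀ g, Ψ g ∈ S := fun g => mem_closedBall_zero_iff.2 <|
    norm_le_of_weightLE_unweight hε <|
      (hmaps _ (memBC_unweight hT g.1) (hbound g)).2.congr (hΨ g)
  have hcontracting : ContractingWith (1 / 2) fun g : S => (⟨Ψ g, hΨS g⟩ : S) := by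
    refine ⟨by norm_num, LipschitzWith.of_dist_le_mul fun f g => ?_⟩
    rw [Subtype.dist_eq, Subtype.dist_eq, dist_eq_norm, dist_eq_norm]
    refine norm_le_of_weightLE_unweight (μ := μ) (by positivity) fun t ht => ?_
    have hdist := hcontr _ _ (memBC_unweight hT f.1) (hbound f) (memBC_unweight hT g.1) (hbound g)
      _ ((weightLE_unweight (f.1 - g.1)).congr fun t _ => by rw [map_sub, Pi.sub_apply]) t ht
    rw [map_sub, Pi.sub_apply, hΨ f ht, hΨ g ht]
    exact hdist.trans_eq (by push_cast; ring)
  have : CompleteSpace S := Metric.isClosed_closedBall.completeSpace_coe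
  have : Nonempty S := ⟨⟨0, Metric.mem_closedBall_self hε⟩⟩
  set g := hcontracting.fixedPoint
  refine ⟨unweight μ g.1, memBC_unweight hT g.1, hbound g, fun t ht => ?_⟩
  rw [← hΨ g ht]
  exact congrArg (fun g : S => unweight μ g.1 t) hcontracting.fixedPoint_isFixedPt

end WeightedSpace

section Delay

open MeasureTheory

theorem integral_delay {E : Type*} [NormedAddCommGroup E] [NormedSpace ℝ E] {f : ℝ → E}
    {s t : ℝ} (hf : ContinuousOn f (Icc 0 (max (t - s) 0))) (hf0 : f 0 = 0) (hs : 0 ≤ s)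
    (ht : 0 ≤ t) :
    ∫ r in (0 : ℝ)..t, f (max (r - s) 0) = ∫ r in (0 : ℝ)..max (t - s) 0, f r := by
  have hdelay : ContinuousOn (fun r => f (max (r - s) 0)) (Icc 0 t) :=
    hf.comp (by fun_prop) fun r hr =>
      ⟨le_max_right _ _, max_le_max_right 0 (sub_le_sub_right hr.2 s)⟩
  have hzero : ∀ r ∈ Icc 0 s, ∫ u in (0 : ℝ)..r, f (max (u - s) 0) = 0 := fun r hr => by
    refine (intervalIntegral.integral_congr (g := fun _ => (0 : E)) fun u hu => ?_).trans (by simp)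
    rw [uIcc_of_le hr.1] at hu
    simp only [max_eq_right (sub_nonpos.2 (hu.2.trans hr.2)), hf0]
  rcases le_total t s with hts | hst
  · rw [hzero t ⟨ht, hts⟩, max_eq_right (sub_nonpos.2 hts), intervalIntegral.integral_same]
  · have hts : 0 ≤ t - s := sub_nonneg.2 hst
    rw [← intervalIntegral.integral_add_adjacent_intervals
      ((hdelay.mono (Icc_subset_Icc_right hst)).intervalIntegrable_of_Icc hs)
      ((hdelay.mono (Icc_subset_Icc_left hs)).intervalIntegrable_of_Icc hst),
      hzero s ⟨hs, le_rfl⟩, zero_add,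
      intervalIntegral.integral_comp_sub_right (fun r => f (max r 0)), sub_self, max_eq_left hts]
    refine intervalIntegral.integral_congr fun u hu => ?_
    rw [uIcc_of_le hts] at hu
    simp only [max_eq_left hu.1]

end Delay

section Linear

open MeasureTheory
open scoped ZeroAtInfty

variable {E₀ E₁ : Type*} [NormedAddCommGroup E₀] [NormedSpace ℝ E₀]
  [NormedAddCommGroup E₁] [NormedSpace ℝ E₁]
  {i : E₁ →L[ℝ] E₀} {μ ν T δ C M : ℝ} {B : E₁ →L[ℝ] E₀} {x : E₀} {f : ℝ → E₀} {v w : ℝ → E₁}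

/-- Uniqueness for `v' + B v = f`, `v(0) = x` in `𝔼_{1,μ}([0,T])`, reduced to zero data. -/
def ZeroDataUnique (i : E₁ →L[ℝ] E₀) (μ T : ℝ) (B : E₁ →L[ℝ] E₀) : Prop :=
  ∀ w : ℝ → E₁, IsPrimitive i μ T 0 w (fun t => -B (w t)) → EqOn w 0 (Ioc 0 T)

/-- The problem `v' + B v = f`, `v(0) = 0` has, for every `f ∈ BC_{1-μ}([0,T], E₀)`, a solution in
`𝔼_{1,μ}([0,T])` that is bounded by `C` times the norm of `f`. -/
def SolvableWithBound (i : E₁ →L[ℝ] E₀) (μ T C : ℝ) (B : E₁ →L[ℝ] E₀) : Prop :=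
  ∀ f : ℝ → E₀, MemBC μ T f → ∃ v, IsPrimitive i μ T 0 v (fun t => f t - B (v t)) ∧
    ∀ M, WeightLE μ T M f → WeightLE μ T (C * M) v

theorem ZeroDataUnique.eqOn (huniq : ZeroDataUnique i μ T B) (hμ : 0 < μ) (hT : 0 < T)
    (hv : IsPrimitive i μ T x v (fun t => f t - B (v t)))
    (hw : IsPrimitive i μ T x w (fun t => f t - B (w t))) : EqOn v w (Ioc 0 T) := by
  have hsub := hv.sub hμ hw
  rw [sub_self] at hsub
  intro t ht
  refine sub_eq_zero.1 (huniq _ (hsub.congr hT (fun _ _ => rfl) fun s _ => ?_) ht)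
  simp only [map_sub]
  abel

theorem isPrimitive_delay (hμ : μ < 1) {W : ℝ → E₁} {s : ℝ} (hs : 0 ≤ s) (hsT : s < T)
    (hW : ContinuousOn W (Icc 0 (T - s))) (hW0 : W 0 = 0)
    (hiW : ∀ t ∈ Icc 0 (T - s), i (W t) = ∫ r in (0 : ℝ)..t, -B (W r)) :
    IsPrimitive i μ T 0 (fun t => W (max (t - s) 0)) (fun t => -B (W (max (t - s) 0))) := by
  have hmaps : MapsTo (fun t => max (t - s) 0) (Icc 0 T) (Icc 0 (T - s)) := fun t ht =>
    ⟨le_max_right _ _, max_le (sub_le_sub_right ht.2 s) (sub_nonneg.2 hsT.le)⟩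
  have hZ : MemBC μ T fun t => W (max (t - s) 0) :=
    memBC_of_continuousOn_Icc hμ (hs.trans_lt hsT) (hW.comp (by fun_prop) hmaps)
  refine ⟨hZ, (hZ.clm B).neg, fun t ht => ?_⟩
  have hmax := hmaps (Ioc_subset_Icc_self ht)
  rw [zero_add, hiW _ hmax, ← integral_delay (f := fun r => -B (W r))
    (B.continuous.comp_continuousOn (hW.mono (Icc_subset_Icc_right hmax.2))).neg
    (by rw [hW0, map_zero, neg_zero]) hs ht.1.le]

theorem IsPrimitive.of_tendsto {ι : Type*} {l : Filter ι} [l.NeBot] (hμ : 0 < μ)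
    {u : ι → ℝ → E₁} {h : ι → ℝ → E₀} {g : ℝ → E₀} (H : ∀ n, IsPrimitive i μ T x (u n) (h n))
    (hv : MemBC μ T v) (hg : MemBC μ T g) {a b : ι → ℝ} (ha : Tendsto a l (𝓝 0))
    (hb : Tendsto b l (𝓝 0)) (huv : ∀ n, WeightLE μ T (a n) (fun t => u n t - v t))
    (hhg : ∀ n, WeightLE μ T (b n) (fun t => h n t - g t)) : IsPrimitive i μ T x v g := by
  refine ⟨hv, hg, fun t ht => ?_⟩
  have h0 : (0 : ℝ) ∈ Icc 0 T := ⟨le_rfl, ht.1.le.trans ht.2⟩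
  have hvalue : Tendsto (fun n => i (u n t)) l (𝓝 (i (v t))) := by
    refine (i.continuous.tendsto _).comp (tendsto_iff_norm_sub_tendsto_zero.2 ?_)
    refine squeeze_zero (fun _ => norm_nonneg _) (fun n => norm_le_mul_rpow ht.1 (huv n t ht)) ?_
    simpa using ha.mul_const (t ^ (μ - 1))
  have hintegral : Tendsto (fun n => ∫ s in (0 : ℝ)..t, h n s) l (𝓝 (∫ s in (0 : ℝ)..t, g s)) := by
    refine tendsto_iff_norm_sub_tendsto_zero.2 (squeeze_zero (fun _ => norm_nonneg _) (fun n => ?_)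
      (show Tendsto (fun n => b n * t ^ μ / μ) l (𝓝 0) by
        simpa using (hb.mul_const (t ^ μ)).div_const μ))
    rw [← intervalIntegral.integral_sub
      ((H n).memBC_deriv.intervalIntegrable hμ h0 ⟨ht.1.le, ht.2⟩)
      (hg.intervalIntegrable hμ h0 ⟨ht.1.le, ht.2⟩)]
    exact ((hhg n).mono_right ht.2).norm_integral_le hμ ht.1.le
  exact tendsto_nhds_unique hvalue
    ((hintegral.const_add x).congr fun n => ((H n).integral_eq t ht).symm)

/-- Truncating `f` at time `t` and extending it homogeneously turns the estimate with weight `μ` on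
`[0,T]` into pointwise estimates at `t` with every weight `ν ≥ μ`. -/
theorem SolvableWithBound.weightLE (hμ : 0 < μ) (hμν : μ ≤ ν)
    (huniq : ∀ δ ∈ Ioc 0 T, ZeroDataUnique i μ δ B) (hsolv : SolvableWithBound i μ T C B)
    (hδ : δ ≤ T) (hf : MemBC μ δ f) (hv : IsPrimitive i μ δ 0 v (fun t => f t - B (v t)))
    (hM : WeightLE ν δ M f) : WeightLE ν δ (C * M) v := fun t ht => by
  have htT := ht.2.trans hδ
  obtain ⟨g, hgf, hg, hgM⟩ := (hf.mono_right ht.2).exists_extend ht.1 T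
  obtain ⟨w, hw, hwM⟩ := hsolv g hg
  have hvw : v t = w t := (huniq t ⟨ht.1, htT⟩).eqOn hμ ht.1 (hv.mono_right ht.2)
    ((hw.mono_right htT).congr ht.1 (fun _ _ => rfl) fun s hs => by simp only [hgf hs])
    ⟨ht.1, le_rfl⟩
  have hfM : WeightLE μ t (t ^ (ν - μ) * M) f := fun s hs =>
    (rpow_mul_norm_le hs hμν (f s)).trans
      (mul_le_mul_of_nonneg_left (hM s ⟨hs.1, hs.2.trans ht.2⟩) (Real.rpow_nonneg ht.1.le _))
  refine le_of_mul_le_mul_left ?_ (Real.rpow_pos_of_pos ht.1 (ν - μ))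
  calc t ^ (ν - μ) * (t ^ (1 - ν) * ‖v t‖) = t ^ (1 - μ) * ‖w t‖ := by
        rw [hvw, ← mul_assoc, ← Real.rpow_add ht.1, show ν - μ + (1 - ν) = 1 - μ by ring]
    _ ≤ C * (t ^ (ν - μ) * M) := hwM _ (hgM _ hfM) t ⟨ht.1, htT⟩
    _ = t ^ (ν - μ) * (C * M) := mul_left_comm _ _ _

theorem SolvableWithBound.memBC (hμ : 0 < μ) (hμν : μ ≤ ν)
    (huniq : ∀ δ ∈ Ioc 0 T, ZeroDataUnique i μ δ B) (hC : 0 ≤ C)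
    (hsolv : SolvableWithBound i μ T C B) (hδ : δ ∈ Ioc 0 T) (hf : MemBC ν δ f)
    (hv : IsPrimitive i μ δ 0 v (fun t => f t - B (v t))) : MemBC ν δ v := by
  refine memBC_of_eventually_le hv.memBC.continuousOn fun ε hε => ?_
  have hη : 0 < ε / (C + 1) := by positivity
  filter_upwards [Ioc_mem_nhdsGT hδ.1, hf.eventually_weightLE hη] with t ht hft
  refine (hsolv.weightLE hμ hμν huniq (ht.2.trans hδ.2) ((hf.mono_right ht.2).anti_weight hμν)
    (hv.mono_right ht.2) hft t ⟨ht.1, le_rfl⟩).trans ?_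
  rw [mul_div_assoc', div_le_iff₀ (by positivity)]
  linarith

theorem exists_linear_solutionMap (hμ : 0 < μ) (hT : 0 < T) (huniq : ZeroDataUnique i μ T B)
    (hex : ∀ f : ℝ → E₀, MemBC μ T f → ∃ v, IsPrimitive i μ T 0 v (fun t => f t - B (v t))) :
    ∃ K : C₀(Ioc (0 : ℝ) T, E₀) →ₗ[ℝ] C₀(Ioc (0 : ℝ) T, E₁), ∀ g k,
      IsPrimitive i μ T 0 (unweight μ k) (fun t => unweight μ g t - B (unweight μ k t)) ↔
        k = K g := by
  have hexC : ∀ g : C₀(Ioc (0 : ℝ) T, E₀), ∃ k : C₀(Ioc (0 : ℝ) T, E₁),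
      IsPrimitive i μ T 0 (unweight μ k) (fun t => unweight μ g t - B (unweight μ k t)) := by
    intro g
    obtain ⟨v, hv⟩ := hex _ (memBC_unweight hT g)
    obtain ⟨k, hk⟩ := hv.memBC.exists_unweight_eqOn hT
    exact ⟨k, hv.congr hT hk fun t ht => by simp only [hk ht]⟩
  choose K hK using hexC
  have hKuniq : ∀ {g k}, IsPrimitive i μ T 0 (unweight μ k)
      (fun t => unweight μ g t - B (unweight μ k t)) → k = K g := fun hk =>
    eq_of_eqOn_unweight (huniq.eqOn hμ hT hk (hK _))
  refine ⟨{ toFun := K, map_add' := fun f g => ?_, map_smul' := fun c g => ?_ }, fun g k =>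
    ⟨hKuniq, fun h => h ▸ hK g⟩⟩
  · refine (hKuniq ?_).symm
    have hadd := (hK f).add hμ (hK g)
    rw [add_zero] at hadd
    refine hadd.congr hT (fun t _ => by rw [map_add, Pi.add_apply]) fun t _ => ?_
    simp only [map_add, Pi.add_apply]
    abel
  · refine (hKuniq ?_).symm
    have hsmul := (hK g).const_smul c
    rw [smul_zero] at hsmul
    refine hsmul.congr hT (fun t _ => by rw [map_smul, Pi.smul_apply]; rfl) fun t _ => ?_
    simp only [map_smul, Pi.smul_apply, RingHom.id_apply, smul_sub]

theorem exists_solvableWithBound [CompleteSpace E₀] [CompleteSpace E₁] (hμ : 0 < μ) (hT : 0 < T)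
    (huniq : ZeroDataUnique i μ T B)
    (hex : ∀ f : ℝ → E₀, MemBC μ T f → ∃ v, IsPrimitive i μ T 0 v (fun t => f t - B (v t))) :
    ∃ C ≥ 0, SolvableWithBound i μ T C B := by
  obtain ⟨K, hK⟩ := exists_linear_solutionMap hμ hT huniq hex
  have hcont : Continuous K := by
    refine K.continuous_of_seq_closed_graph fun u g k hu hk => (hK g k).1 ?_
    have hu := tendsto_iff_norm_sub_tendsto_zero.1 hu
    have hk := tendsto_iff_norm_sub_tendsto_zero.1 hk
    have hKu : ∀ n, WeightLE μ T ‖K (u n) - k‖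
        (fun t => unweight μ (K (u n)) t - unweight μ k t) := fun n =>
      (weightLE_unweight _).congr fun t _ => by rw [map_sub, Pi.sub_apply]
    refine .of_tendsto hμ (fun n => (hK (u n) _).2 rfl) (memBC_unweight hT k)
      ((memBC_unweight hT g).sub ((memBC_unweight hT k).clm B)) hk
      (by simpa using hu.add (hk.const_mul ‖B‖)) hKu fun n => ?_
    refine ((weightLE_unweight (u n - g)).sub ((hKu n).clm B)).congr fun t _ => ?_
    simp only [map_sub, Pi.sub_apply]
    abel
  obtain ⟨C, hC, hKC⟩ := SemilinearMapClass.bound_of_continuous K hcont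
  refine ⟨C, hC.le, fun f hf => ?_⟩
  obtain ⟨g, hg⟩ := hf.exists_unweight_eqOn hT
  refine ⟨unweight μ (K g), ((hK g _).2 rfl).congr hT (fun _ _ => rfl) fun t ht => by
    simp only [hg ht], fun M hM => (weightLE_unweight (K g)).mono ((hKC g).trans ?_)⟩
  gcongr
  exact norm_le_of_weightLE_unweight (hM.nonneg hT) (hM.congr hg)

theorem isLinearSolution_iff [CompleteSpace E₀] (hμ : 0 < μ) (hT : 0 < T) :
    IsLinearSolution i μ T B f x v ↔ IsPrimitive i μ T x v (fun t => f t - B (v t)) := by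
  constructor
  · rintro ⟨hv, hx, heq⟩
    exact (hv.isPrimitive hμ hx).congr hT (fun _ _ => rfl) fun t ht => by
      rw [← heq t ht, add_sub_cancel_right]
  · exact fun h => ⟨h.memE1 hμ hT, h.hasTrace hμ hT, fun t ht => by
      rw [h.timeDeriv_eq hμ ht, sub_add_cancel]⟩

/-- The norm of the space with weight `ν` at time `t`: the larger one of `t^{1-ν} |a|_{E₁}` and
`|a|_{E_ν}`. -/
noncomputable def weightedNorm (i : E₁ →L[ℝ] E₀) (ν t : ℝ) (a : E₁) : ℝ :=
  max (t ^ (1 - ν) * ‖a‖) (interpNorm i ν (i a))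

theorem IsPrimitive.weightedNorm_le (hν : 0 < ν) (hν1 : ν < 1) (hT : 0 < T) {D : ℝ} (hD : 0 ≤ D)
    (hv : IsPrimitive i ν T x v (fun t => f t - B (v t))) (hM : WeightLE ν T M f)
    (hvM : WeightLE ν T (D * (M + interpNorm i ν x)) v) :
    ∀ t ∈ Ioc 0 T, weightedNorm i ν t (v t) ≤
      ((1 / ν + 2) * (1 + (1 + ‖B‖) * D) + 1) * (M + interpNorm i ν x) := fun t ht => by
  have hN := interpNorm_nonneg i ν x
  have hM0 := hM.nonneg hT
  set S := M + interpNorm i ν x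
  set D' := 1 + (1 + ‖B‖) * D with hD'
  have hDS : 0 ≤ D * S := by positivity
  have hBDS : 0 ≤ ‖B‖ * (D * S) := by positivity
  have hvS : WeightLE ν t (D' * S) v := (hvM.mono_right ht.2).mono (by rw [hD']; linarith)
  have hgS : WeightLE ν t (D' * S) (fun t => f t - B (v t)) :=
    ((hM.sub (hvM.clm B)).mono_right ht.2).mono (by rw [hD']; linarith)
  have hsub := hv.interpNorm_sub_le hν hν1 ht hvS hgS
  have htrace := interpNorm_le_sub_add hν.le (apply_mem_interpSpace hν1 (v t))
    (hv.mem_interpSpace hν hT)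
  have hS0 : 0 ≤ D' * S := hvS.nonneg ht.1
  have hνS : 0 ≤ 1 / ν * (D' * S) := by positivity
  refine max_le ((hvS t ⟨ht.1, le_rfl⟩).trans ?_) ?_ <;> linarith [hS0]

variable [CompleteSpace E₀] [CompleteSpace E₁]

theorem ZeroDataUnique.of_le (hi : Function.Injective i) (hμ : 0 < μ) (hμ1 : μ < 1)
    (huniq : ZeroDataUnique i μ T B) (hδ : δ ∈ Ioc 0 T) : ZeroDataUnique i μ δ B := by
  intro w hw
  set W : ℝ → E₁ := fun t => ∫ r in (0 : ℝ)..t, w r with hW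
  have h0 : (0 : ℝ) ∈ Icc 0 δ := ⟨le_rfl, hδ.1.le⟩
  have hint : ∀ t ∈ Icc 0 δ, IntervalIntegrable w volume 0 t := fun t ht =>
    hw.memBC.intervalIntegrable hμ h0 ht
  have hWcont : ContinuousOn W (Icc 0 δ) := by
    have hprim := intervalIntegral.continuousOn_primitive_interval'
      (hint δ ⟨hδ.1.le, le_rfl⟩) left_mem_uIcc
    rwa [uIcc_of_le hδ.1.le] at hprim
  have hiw : ∀ t ∈ Ioc 0 δ, i (w t) = -B (W t) := fun t ht => by
    rw [hw.integral_eq t ht, zero_add, intervalIntegral.integral_neg,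
      B.intervalIntegral_comp_comm (hint t (Ioc_subset_Icc_self ht))]
  have hiW : ∀ t ∈ Icc 0 δ, i (W t) = ∫ r in (0 : ℝ)..t, -B (W r) := fun t ht => by
    rw [hW, ← i.intervalIntegral_comp_comm (hint t ht)]
    refine intervalIntegral.integral_congr_ae (.of_forall fun r hr => ?_)
    rw [uIoc_of_le ht.1] at hr
    exact hiw r ⟨hr.1, hr.2.trans ht.2⟩
  -- `W` solves the same equation and is continuous up to `0`, so it can be delayed by `T - δ`.
  have hdelay := huniq _ (isPrimitive_delay (s := T - δ) hμ1 (sub_nonneg.2 hδ.2)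
    (sub_lt_self T hδ.1) (by rwa [sub_sub_cancel]) intervalIntegral.integral_same
    (by rwa [sub_sub_cancel]))
  intro t ht
  have hWt : W t = 0 := by
    simpa [max_eq_left ht.1.le] using hdelay (show t + (T - δ) ∈ Ioc 0 T from
      ⟨by linarith [ht.1, hδ.2], by linarith [ht.2]⟩)
  refine hi ?_
  rw [hiw t ht, hWt]
  simp

theorem exists_solvableWithBound_of_mem_maxReg (hi : Function.Injective i) (hμ : 0 < μ)
    (hμ1 : μ < 1) (hB : B ∈ maxReg i μ) :
    ∃ T > 0, (∀ δ ∈ Ioc 0 T, ZeroDataUnique i μ δ B) ∧ ∃ C ≥ 0, SolvableWithBound i μ T C B := by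
  obtain ⟨T, hT, H⟩ := hB
  simp only [isLinearSolution_iff hμ hT] at H
  have huniq : ZeroDataUnique i μ T B := fun w hw => by
    obtain ⟨v, -, hv⟩ := H (fun _ => 0) .zero 0 zero_mem_interpSpace
    exact (hv w (by simpa using hw)).trans (hv (fun _ => 0) (by simpa using IsPrimitive.zero)).symm
  exact ⟨T, hT, fun δ hδ => huniq.of_le hi hμ hμ1 hδ, exists_solvableWithBound hμ hT huniq
    fun f hf => (H f hf 0 zero_mem_interpSpace).imp fun v hv => hv.1⟩

theorem exists_reduction_to_zero_trace (hν : 0 < ν) (hx : x ∈ interpSpace i ν) (B : E₁ →L[ℝ] E₀)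
    (hδ : 0 < δ) (hf : MemBC ν δ f) :
    ∃ (w : ℝ → E₁) (f' : ℝ → E₀), MemBC ν δ f' ∧
      WeightLE ν δ (24 * interpNorm i ν x) w ∧
      (∀ M, WeightLE ν δ M f → WeightLE ν δ (M + 24 * (‖B‖ + 1) * interpNorm i ν x) f') ∧
      ∀ v, IsPrimitive i ν δ x v (fun t => f t - B (v t)) ↔
        IsPrimitive i ν δ 0 (fun t => v t - w t) (fun t => f' t - B (v t - w t)) := by
  obtain ⟨w, g, hw, hwM, hgM⟩ := exists_isPrimitive_of_mem_interpSpace hν hx δ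
  refine ⟨w, fun t => f t - B (w t) - g t, (hf.sub (hw.memBC.clm B)).sub hw.memBC_deriv,
    hwM, fun M hM => ((hM.sub (hwM.clm B)).sub hgM).mono (by linarith), fun v => ⟨fun hv => ?_,
    fun hz => ?_⟩⟩
  · have hsub := hv.sub hν hw
    rw [sub_self] at hsub
    exact hsub.congr hδ (fun _ _ => rfl) fun t _ => by simp only [map_sub]; abel
  · have hadd := hz.add hν hw
    rw [zero_add] at hadd
    exact hadd.congr hδ (fun t _ => (sub_add_cancel (v t) (w t)).symm) fun t _ => by
      simp only [map_sub]; abel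

/-- Maximal regularity of `v' + B v = f`, `v(0) = x` on `[0,T]` with weight `ν`, in quantitative
form: solvability and an estimate of `v(t)` in `E₁` and in `E_ν` by `C (|f| + |x|_{E_ν})`. -/
structure HasMaxRegBound (i : E₁ →L[ℝ] E₀) (ν T C : ℝ) (B : E₁ →L[ℝ] E₀) : Prop where
  exists_isPrimitive : ∀ f : ℝ → E₀, MemBC ν T f → ∀ x ∈ interpSpace i ν,
    ∃ v, IsPrimitive i ν T x v (fun t => f t - B (v t))
  weightedNorm_le : ∀ {f : ℝ → E₀} {x : E₀} {v : ℝ → E₁} {M : ℝ}, MemBC ν T f →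
    IsPrimitive i ν T x v (fun t => f t - B (v t)) → WeightLE ν T M f →
      ∀ t ∈ Ioc 0 T, weightedNorm i ν t (v t) ≤ C * (M + interpNorm i ν x)

theorem SolvableWithBound.weightLE_of_isPrimitive (hμ : 0 < μ) (hμν : μ ≤ ν)
    (huniq : ∀ δ ∈ Ioc 0 T, ZeroDataUnique i μ δ B) (hC : 0 ≤ C)
    (hsolv : SolvableWithBound i μ T C B) (hδ : δ ∈ Ioc 0 T) (hf : MemBC ν δ f)
    (hv : IsPrimitive i ν δ x v (fun t => f t - B (v t))) (hM : WeightLE ν δ M f) :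
    WeightLE ν δ ((C * (1 + 24 * (‖B‖ + 1)) + 24) * (M + interpNorm i ν x)) v := by
  have hν := hμ.trans_le hμν
  obtain ⟨w, f', hf', hwM, hf'M, hiff⟩ :=
    exists_reduction_to_zero_trace hν (hv.mem_interpSpace hν hδ.1) B hδ.1 hf
  have hz := hsolv.weightLE hμ hμν huniq hδ.2 (hf'.anti_weight hμν)
    (((hiff v).1 hv).anti_weight hμν) (hf'M M hM)
  have hN := interpNorm_nonneg i ν x
  have hM0 := hM.nonneg hδ.1
  refine ((hz.add hwM).congr fun t _ => (sub_add_cancel (v t) (w t)).symm).mono ?_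
  have hslack : 0 ≤ C * (24 * (‖B‖ + 1)) * M + C * interpNorm i ν x + 24 * M := by positivity
  linarith

theorem exists_hasMaxRegBound (hi : Function.Injective i) (hμ : 0 < μ) (hμν : μ ≤ ν)
    (hν1 : ν < 1) (hB : B ∈ maxReg i μ) :
    ∃ T > 0, ∃ C > 0, ∀ δ ∈ Ioc 0 T, HasMaxRegBound i ν δ C B := by
  have hν := hμ.trans_le hμν
  obtain ⟨T, hT, huniq, C, hC, hsolv⟩ :=
    exists_solvableWithBound_of_mem_maxReg hi hμ (hμν.trans_lt hν1) hB
  refine ⟨T, hT, (1 / ν + 2) * (1 + (1 + ‖B‖) * (C * (1 + 24 * (‖B‖ + 1)) + 24)) + 1,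
    by positivity, fun δ hδ => ⟨fun f hf x hx => ?_, fun hf hv hM =>
      hv.weightedNorm_le hν hν1 hδ.1 (by positivity) hM
        (hsolv.weightLE_of_isPrimitive hμ hμν huniq hC hδ hf hv hM)⟩⟩
  obtain ⟨w, f', hf', -, -, hiff⟩ := exists_reduction_to_zero_trace hν hx B hδ.1 hf
  obtain ⟨e, hef, he, -⟩ := (hf'.anti_weight hμν).exists_extend hδ.1 T
  obtain ⟨z, hz, -⟩ := hsolv e he
  have hz : IsPrimitive i μ δ 0 z (fun t => f' t - B (z t)) :=
    (hz.mono_right hδ.2).congr hδ.1 (fun _ _ => rfl) fun t ht => by simp only [hef ht]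
  have hzν : MemBC ν δ z := hsolv.memBC hμ hμν huniq hC hδ hf' hz
  refine ⟨fun t => z t + w t, (hiff _).2 ?_⟩
  simpa only [add_sub_cancel_right] using
    (⟨hzν, hf'.sub (hzν.clm B), hz.integral_eq⟩ : IsPrimitive i ν δ 0 z _)

end Linear

section TimeWeights

variable {E₀ E₁ : Type*} [NormedAddCommGroup E₀] [NormedSpace ℝ E₀]
  [NormedAddCommGroup E₁] [NormedSpace ℝ E₁]
  {i : E₁ →L[ℝ] E₀} {μ β T t : ℝ} {x : E₀} {v : ℝ → E₁} {g : ℝ → E₀}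

theorem rpow_mul_norm_le_weightedNorm (μ t : ℝ) (a : E₁) :
    t ^ (1 - μ) * ‖a‖ ≤ weightedNorm i μ t a :=
  le_max_left _ _

theorem interpNorm_le_weightedNorm (μ t : ℝ) (a : E₁) :
    interpNorm i μ (i a) ≤ weightedNorm i μ t a :=
  le_max_right _ _

theorem weightedNorm_nonneg (μ t : ℝ) (a : E₁) : 0 ≤ weightedNorm i μ t a :=
  (interpNorm_nonneg i μ _).trans (interpNorm_le_weightedNorm μ t a)

theorem rpow_mul_interpNorm_apply_le {b : ℝ} (hμ : 0 ≤ μ) (hμ1 : μ < 1) (hμb : μ ≤ b)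
    (hb1 : b ≤ 1) (ht : 0 < t) (a : E₁) :
    t ^ (1 - μ) * interpNorm i b (i a) ≤ t ^ (1 - b) * weightedNorm i μ t a := by
  have hd : 0 < 1 - μ := sub_pos.2 hμ1
  have hp0 : 0 ≤ (1 - b) / (1 - μ) := div_nonneg (sub_nonneg.2 hb1) hd.le
  have hq0 : 0 ≤ (b - μ) / (1 - μ) := div_nonneg (sub_nonneg.2 hμb) hd.le
  have hpq : (1 - b) / (1 - μ) + (b - μ) / (1 - μ) = 1 := by field_simp; ring
  have hsplit : t ^ (1 - μ) = t ^ (1 - b) * (t ^ (1 - μ)) ^ ((b - μ) / (1 - μ)) := by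
    rw [← Real.rpow_mul ht.le, ← Real.rpow_add ht, mul_div_cancel₀ _ hd.ne', sub_add_sub_cancel]
  have hN := interpNorm_nonneg i μ (i a)
  calc t ^ (1 - μ) * interpNorm i b (i a)
      ≤ t ^ (1 - μ) * (interpNorm i μ (i a) ^ ((1 - b) / (1 - μ)) *
          ‖a‖ ^ ((b - μ) / (1 - μ))) := by
        gcongr
        exact interpNorm_apply_le_rpow_mul_rpow hμ hμb hμ1 hb1 a
    _ = t ^ (1 - b) * (interpNorm i μ (i a) ^ ((1 - b) / (1 - μ)) *
          (t ^ (1 - μ) * ‖a‖) ^ ((b - μ) / (1 - μ))) := by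
        rw [Real.mul_rpow (Real.rpow_nonneg ht.le _) (norm_nonneg _)]
        nth_rewrite 1 [hsplit]
        ring
    _ ≤ t ^ (1 - b) * (weightedNorm i μ t a ^ ((1 - b) / (1 - μ)) *
          weightedNorm i μ t a ^ ((b - μ) / (1 - μ))) := by
        gcongr
        · exact Real.rpow_nonneg (weightedNorm_nonneg μ t a) _
        · exact interpNorm_le_weightedNorm μ t a
        · exact rpow_mul_norm_le_weightedNorm μ t a
    _ = t ^ (1 - b) * weightedNorm i μ t a := by
        rw [← Real.rpow_add_of_nonneg (weightedNorm_nonneg μ t a) hp0 hq0, hpq, Real.rpow_one]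

theorem tendsto_rpow_mul_rpow {φ : ℝ → ℝ} {b ρ : ℝ} (hφ0 : ∀ t, 0 ≤ φ t)
    (hφ : Tendsto (fun t => t ^ (β - μ) * φ t) (𝓝[>] 0) (𝓝 0)) (hb : b < 1) (hρ : 0 ≤ ρ)
    (h : ρ * (β - μ) + (b - μ) ≤ 1 - μ) :
    Tendsto (fun t => t ^ (1 - b) * φ t ^ ρ) (𝓝[>] 0) (𝓝 0) := by
  rcases hρ.eq_or_lt with rfl | hρ0
  · simpa using tendsto_rpow_nhdsGT_zero (sub_pos.2 hb)
  have hpow : Tendsto (fun t => (t ^ (β - μ) * φ t) ^ ρ) (𝓝[>] 0) (𝓝 0) := by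
    simpa [Real.zero_rpow hρ0.ne'] using hφ.rpow_const (p := ρ) (.inr hρ)
  refine tendsto_of_tendsto_of_tendsto_of_le_of_le' tendsto_const_nhds hpow ?_ ?_
  · filter_upwards [self_mem_nhdsWithin] with t ht
    exact mul_nonneg (Real.rpow_nonneg (le_of_lt ht) _) (Real.rpow_nonneg (hφ0 t) _)
  · filter_upwards [Ioc_mem_nhdsGT one_pos] with t ht
    rw [Real.mul_rpow (Real.rpow_nonneg ht.1.le _) (hφ0 t), ← Real.rpow_mul ht.1.le]
    exact mul_le_mul_of_nonneg_right
      (Real.rpow_le_rpow_of_exponent_ge ht.1 ht.2 (by linarith)) (Real.rpow_nonneg (hφ0 t) _)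

theorem IsPrimitive.tendsto_rpow_mul_interpNorm (hμ : 0 < μ) (hμβ : μ < β) (hβ1 : β < 1)
    (hT : 0 < T) (H : IsPrimitive i μ T x v g) :
    Tendsto (fun t => t ^ (β - μ) * interpNorm i β (i (v t))) (𝓝[>] 0) (𝓝 0) := by
  have hμ1 := hμβ.trans hβ1
  have hd : 0 < 1 - μ := sub_pos.2 hμ1
  have hx := H.mem_interpSpace hμ hT
  set q := (β - μ) / (1 - μ)
  have hq : 0 < q := div_pos (sub_pos.2 hμβ) hd
  have hp : 0 ≤ (1 - β) / (1 - μ) := div_nonneg (sub_nonneg.2 hβ1.le) hd.le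
  set N := (1 + interpNorm i μ x) ^ ((1 - β) / (1 - μ))
  have hlim : Tendsto (fun t => N * (t ^ (1 - μ) * ‖v t‖) ^ q) (𝓝[>] 0) (𝓝 0) := by
    simpa [Real.zero_rpow hq.ne'] using
      (H.memBC.tendsto_zero.rpow_const (p := q) (.inr hq.le)).const_mul N
  refine tendsto_of_tendsto_of_tendsto_of_le_of_le' tendsto_const_nhds hlim ?_ ?_
  · filter_upwards [self_mem_nhdsWithin] with t ht
    exact mul_nonneg (Real.rpow_nonneg (le_of_lt ht) _) (interpNorm_nonneg _ _ _)
  · filter_upwards [self_mem_nhdsWithin,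
      (H.tendsto_interpNorm_sub hμ hμ1 hT).eventually_le_const one_pos] with t ht hsub
    have ht : 0 < t := ht
    have hbound : interpNorm i μ (i (v t)) ≤ 1 + interpNorm i μ x :=
      (interpNorm_le_sub_add hμ.le (apply_mem_interpSpace hμ1 (v t)) hx).trans (by gcongr)
    have hpow : t ^ (β - μ) = (t ^ (1 - μ)) ^ q := by
      rw [← Real.rpow_mul ht.le, mul_div_cancel₀ _ hd.ne']
    rw [Real.mul_rpow (Real.rpow_nonneg ht.le _) (norm_nonneg _), ← hpow, mul_left_comm]
    gcongr
    refine (interpNorm_apply_le_rpow_mul_rpow hμ.le hμβ.le hμ1 hβ1.le (v t)).trans ?_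
    gcongr
    exact Real.rpow_le_rpow (interpNorm_nonneg _ _ _) hbound hp

end TimeWeights

section Frozen

open scoped NNReal

variable {E₀ E₁ G : Type*} [NormedAddCommGroup E₀] [NormedSpace ℝ E₀]
  [NormedAddCommGroup E₁] [NormedSpace ℝ E₁] [NormedAddCommGroup G]
  {i : E₁ →L[ℝ] E₀} {μ ν β t η : ℝ} {L : ℝ≥0} {s V : Set E₀} {Φ Ψ : E₀ → G}
  {A : E₀ → E₁ →L[ℝ] E₀} {F F₁ F₂ : E₀ → E₀} {x y : E₀} {a b : E₁}

/-- `Φ` is Lipschitz continuous on `s` with constant `L` in the norm of `E_ν`. -/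
def InterpLipschitzOn (i : E₁ →L[ℝ] E₀) (ν : ℝ) (L : ℝ≥0) (s : Set E₀) (Φ : E₀ → G) : Prop :=
  ∀ y ∈ s, ∀ z ∈ s, ‖Φ y - Φ z‖ ≤ L * interpNorm i ν (y - z)

/-- At time `t`, the point `a` is `η`-close to the initial value `x`: both `t^{1-ν} |a|_{E₁}` and
`|a - x|_{E_ν}` are at most `η`. -/
def InTube (i : E₁ →L[ℝ] E₀) (ν : ℝ) (x : E₀) (η t : ℝ) (a : E₁) : Prop :=
  t ^ (1 - ν) * ‖a‖ ≤ η ∧ interpNorm i ν (i a - x) ≤ η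

/-- The right hand side of `v' + B v = (B - A(v)) v + F(v)`, which is the quasilinear equation
`v' + A(v) v = F(v)` with coefficient frozen at `B`. -/
def frozenRHS (i : E₁ →L[ℝ] E₀) (B : E₁ →L[ℝ] E₀) (A : E₀ → E₁ →L[ℝ] E₀) (F : E₀ → E₀)
    (a : E₁) : E₀ :=
  (B - A (i a)) a + F (i a)

namespace InterpLipschitzOn

theorem of_le_mul {M : ℝ}
    (h : ∀ y ∈ s, ∀ z ∈ s, ‖Φ y - Φ z‖ ≤ M * interpNorm i ν (y - z)) :
    InterpLipschitzOn i ν M.toNNReal s Φ := fun y hy z hz =>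
  (h y hy z hz).trans
    (mul_le_mul_of_nonneg_right (Real.le_coe_toNNReal M) (interpNorm_nonneg _ _ _))

theorem mono {K : ℝ≥0} {s' : Set E₀} (h : InterpLipschitzOn i ν L s Φ) (hLK : L ≤ K)
    (hs : s' ⊆ s) : InterpLipschitzOn i ν K s' Φ := fun y hy z hz =>
  (h y (hs hy) z (hs hz)).trans
    (mul_le_mul_of_nonneg_right (NNReal.coe_le_coe.2 hLK) (interpNorm_nonneg _ _ _))

theorem add {K : ℝ≥0} (hΦ : InterpLipschitzOn i ν L s Φ) (hΨ : InterpLipschitzOn i ν K s Ψ) :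
    InterpLipschitzOn i ν (L + K) s (Φ + Ψ) := fun y hy z hz => by
  rw [Pi.add_apply, Pi.add_apply, add_sub_add_comm, NNReal.coe_add, add_mul]
  exact norm_add_le_of_le (hΦ y hy z hz) (hΨ y hy z hz)

theorem of_weight_le (hμ : 0 ≤ μ) (hμν : μ ≤ ν) (h : InterpLipschitzOn i μ L s Φ)
    (hs : s ⊆ interpSpace i ν) : InterpLipschitzOn i ν (L * (1 + ‖i‖₊)) s Φ := fun y hy z hz => by
  refine (h y hy z hz).trans ?_
  rw [NNReal.coe_mul, NNReal.coe_add, NNReal.coe_one, coe_nnnorm, mul_assoc]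
  gcongr
  exact interpNorm_le_mul_of_le hμ hμν (sub_mem_interpSpace (hs hy) (hs hz))

theorem continuousOn_comp (hν : 0 ≤ ν) (hν1 : ν ≤ 1) (h : InterpLipschitzOn i ν L s Φ)
    {v : ℝ → E₁} {J : Set ℝ} (hv : ContinuousOn v J) (hs : MapsTo (fun t => i (v t)) J s) :
    ContinuousOn (fun t => Φ (i (v t))) J := by
  have hlip : LipschitzOnWith (L * (1 + ‖i‖₊)) (fun a => Φ (i a)) (i ⁻¹' s) := by
    refine .of_dist_le_mul fun a ha b hb => ?_
    rw [dist_eq_norm, dist_eq_norm, NNReal.coe_mul, mul_assoc]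
    refine (h _ ha _ hb).trans ?_
    rw [← map_sub]
    gcongr
    exact interpNorm_apply_le hν hν1 _
  exact hlip.continuousOn.comp hv hs

end InterpLipschitzOn

theorem frozenRHS_sub (B : E₁ →L[ℝ] E₀) (a b : E₁) :
    frozenRHS i B A F a - frozenRHS i B A F b =
      (B - A (i a)) (a - b) - (A (i a) - A (i b)) b + (F (i a) - F (i b)) := by
  simp only [frozenRHS, _root_.sub_apply, map_sub]
  abel

theorem rpow_mul_norm_frozenRHS_sub_le (hA : InterpLipschitzOn i ν L s A)
    (hF : InterpLipschitzOn i ν L s F) (hx : x ∈ s) (ha : i a ∈ s) (hb : i b ∈ s) (ht : 0 < t)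
    (htη : t ^ (1 - ν) ≤ η) (haη : InTube i ν x η t a) (hbη : InTube i ν x η t b) :
    t ^ (1 - ν) * ‖frozenRHS i (A x) A F a - frozenRHS i (A x) A F b‖ ≤
      3 * L * η * weightedNorm i ν t (a - b) := by
  have hp : 0 < t ^ (1 - ν) := Real.rpow_pos_of_pos ht _
  set W := weightedNorm i ν t (a - b)
  have hW : 0 ≤ W := weightedNorm_nonneg ν t (a - b)
  have habW : interpNorm i ν (i a - i b) ≤ W := by
    rw [← map_sub]
    exact interpNorm_le_weightedNorm ν t (a - b)
  have hfreeze : ‖(A x - A (i a)) (a - b)‖ ≤ L * η * ‖a - b‖ :=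
    (A x - A (i a)).le_of_opNorm_le ((hA _ hx _ ha).trans (by
      rw [interpNorm_sub_comm]; gcongr; exact haη.2)) _
  have hcoeff : ‖(A (i a) - A (i b)) b‖ ≤ L * W * ‖b‖ :=
    (A (i a) - A (i b)).le_of_opNorm_le ((hA _ ha _ hb).trans (by gcongr)) _
  have hforce : ‖F (i a) - F (i b)‖ ≤ L * W := (hF _ ha _ hb).trans (by gcongr)
  rw [frozenRHS_sub]
  calc t ^ (1 - ν) * ‖(A x - A (i a)) (a - b) - (A (i a) - A (i b)) b + (F (i a) - F (i b))‖
      ≤ t ^ (1 - ν) * (L * η * ‖a - b‖ + L * W * ‖b‖ + L * W) := by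
        gcongr
        exact norm_add_le_of_le (norm_sub_le_of_le hfreeze hcoeff) hforce
    _ = L * η * (t ^ (1 - ν) * ‖a - b‖) + L * W * (t ^ (1 - ν) * ‖b‖) + L * W * t ^ (1 - ν) := by
        ring
    _ ≤ L * η * W + L * W * η + L * W * η := by
        have hη : 0 ≤ η := hp.le.trans htη
        gcongr
        · exact rpow_mul_norm_le_weightedNorm ν t (a - b)
        · exact hbη.1
    _ = 3 * L * η * W := by ring

theorem rpow_mul_norm_frozenRHS_le (hA : InterpLipschitzOn i ν L s A)
    (hF : InterpLipschitzOn i ν L s F) (hx : x ∈ s) (ha : i a ∈ s) (ht : 0 < t)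
    (haη : interpNorm i ν (i a - x) ≤ η) :
    t ^ (1 - ν) * ‖frozenRHS i (A x) A F a‖ ≤
      L * η * (t ^ (1 - ν) * ‖a‖) + t ^ (1 - ν) * (L * η + ‖F x‖) := by
  have hfreeze : ‖(A x - A (i a)) a‖ ≤ L * η * ‖a‖ :=
    (A x - A (i a)).le_of_opNorm_le ((hA _ hx _ ha).trans (by
      rw [interpNorm_sub_comm]; gcongr)) _
  have hforce : ‖F (i a)‖ ≤ L * η + ‖F x‖ := by
    rw [← sub_add_cancel (F (i a)) (F x)]
    exact norm_add_le_of_le ((hF _ ha _ hx).trans (by gcongr)) le_rfl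
  calc t ^ (1 - ν) * ‖frozenRHS i (A x) A F a‖
      ≤ t ^ (1 - ν) * (L * η * ‖a‖ + (L * η + ‖F x‖)) := by
        gcongr
        exact norm_add_le_of_le hfreeze hforce
    _ = L * η * (t ^ (1 - ν) * ‖a‖) + t ^ (1 - ν) * (L * η + ‖F x‖) := by ring

theorem LocLipCoefficients.exists_interpLipschitzOn (h : LocLipCoefficients i μ V A F₁)
    (hx : x ∈ V) : ∃ r > 0, ∃ L : ℝ≥0,
      InterpLipschitzOn i μ L {y ∈ V | interpNorm i μ (y - x) < r} A ∧
      InterpLipschitzOn i μ L {y ∈ V | interpNorm i μ (y - x) < r} F₁ := by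
  obtain ⟨r, hr, L, hL⟩ := h.2 x hx
  exact ⟨r, hr, L.toNNReal, .of_le_mul fun y hy z hz => (hL y hy.1 z hz.1 hy.2 hz.2).1,
    .of_le_mul fun y hy z hz => (hL y hy.1 z hz.1 hy.2 hz.2).2⟩

theorem SingularStructure.exists_interpLipschitzOn (h : SingularStructure i μ β V F₂)
    (hμ : 0 ≤ μ) (hμβ : μ ≤ β) (hβν : β ≤ ν) (hx : x ∈ V) {R N : ℝ} (hR : 0 < R)
    (hs : s ⊆ closedBallInterp i μ x R ∩ V) (hsν : s ⊆ interpSpace i ν)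
    (hN : ∀ y ∈ s, interpNorm i ν y ≤ N) :
    ∃ L : ℝ≥0, InterpLipschitzOn i ν L s F₂ := by
  obtain ⟨m, b, ρ, hbρ, hF⟩ := h
  obtain ⟨K, hK, hF⟩ := hF x hx R hR
  set c := 1 + ‖i‖
  have hc : 0 ≤ c := by positivity
  have hsβ : ∀ y ∈ s, interpNorm i β y ≤ c * N := fun y hy =>
    (interpNorm_le_mul_of_le (hμ.trans hμβ) hβν (hsν hy)).trans
      (mul_le_mul_of_nonneg_left (hN y hy) hc)
  refine ⟨(K * ∑ j, (1 + (c * N) ^ ρ j + (c * N) ^ ρ j) * c).toNNReal,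
    .of_le_mul fun y hy z hz => (hF y ⟨(hs hy).1, (hs hy).2, interpSpace_anti hβν (hsν hy)⟩ z
      ⟨(hs hz).1, (hs hz).2, interpSpace_anti hβν (hsν hz)⟩).trans ?_⟩
  rw [mul_assoc, Finset.sum_mul]
  refine mul_le_mul_of_nonneg_left (Finset.sum_le_sum fun j _ => ?_) hK.le
  obtain ⟨⟨hμb, hbβ⟩, hρ, -⟩ := hbρ j
  have hcN : 0 ≤ (c * N) ^ ρ j :=
    Real.rpow_nonneg ((interpNorm_nonneg i β y).trans (hsβ y hy)) _
  have hy := Real.rpow_le_rpow (interpNorm_nonneg i β y) (hsβ y hy) hρ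
  have hz := Real.rpow_le_rpow (interpNorm_nonneg i β z) (hsβ z hz) hρ
  rw [mul_assoc]
  gcongr
  · exact interpNorm_nonneg _ _ _
  · exact interpNorm_le_mul_of_le (hμ.trans hμb) (hbβ.trans hβν)
      (sub_mem_interpSpace (hsν ‹_›) (hsν ‹_›))

end Frozen

section Uniqueness

open Asymptotics

variable {E₀ E₁ : Type*} [NormedAddCommGroup E₀] [NormedSpace ℝ E₀]
  [NormedAddCommGroup E₁] [NormedSpace ℝ E₁]
  {i : E₁ →L[ℝ] E₀} {μ ν β T : ℝ} {V : Set E₀} {A : E₀ → E₁ →L[ℝ] E₀} {F₁ F₂ : E₀ → E₀} {x : E₀}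
  {v v₁ v₂ : ℝ → E₁} {g₁ g₂ : ℝ → E₀}

theorem IsPrimitive.eventually_inTube (hν : 0 < ν) (hν1 : ν < 1) (hT : 0 < T)
    (H : IsPrimitive i ν T x v g₁) {η : ℝ} (hη : 0 < η) :
    ∀ᶠ t in 𝓝[>] 0, InTube i ν x η t (v t) :=
  (H.memBC.tendsto_zero.eventually_le_const hη).and
    ((H.tendsto_interpNorm_sub hν hν1 hT).eventually_le_const hη)

theorem LocLipCoefficients.isLittleO (hAF₁ : LocLipCoefficients i μ V A F₁) (hμ : 0 < μ)
    (hμ1 : μ < 1) (hT : 0 < T) (hx : x ∈ V) (h₁ : IsPrimitive i μ T x v₁ g₁)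
    (h₂ : IsPrimitive i μ T x v₂ g₂) (hV₁ : ∀ t ∈ Ioc 0 T, i (v₁ t) ∈ V)
    (hV₂ : ∀ t ∈ Ioc 0 T, i (v₂ t) ∈ V) :
    (fun t => t ^ (1 - μ) •
      (frozenRHS i (A x) A F₁ (v₁ t) - frozenRHS i (A x) A F₁ (v₂ t))) =o[𝓝[>] 0]
        fun t => weightedNorm i μ t (v₁ t - v₂ t) := by
  obtain ⟨r, hr, L, hA, hF⟩ := hAF₁.exists_interpLipschitzOn hx
  refine isLittleO_iff.2 fun c hc => ?_
  have hη : 0 < min (r / 2) (c / (3 * L + 1)) := lt_min (by positivity) (by positivity)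
  set η := min (r / 2) (c / (3 * L + 1))
  have hηr : η < r := (min_le_left _ _).trans_lt (half_lt_self hr)
  have hηc : 3 * L * η ≤ c := by
    have hle : η ≤ c / (3 * L + 1) := min_le_right _ _
    rw [le_div_iff₀ (by positivity)] at hle
    linarith
  filter_upwards [Ioc_mem_nhdsGT hT, h₁.eventually_inTube hμ hμ1 hT hη,
    h₂.eventually_inTube hμ hμ1 hT hη,
    (tendsto_rpow_nhdsGT_zero (sub_pos.2 hμ1)).eventually_le_const hη] with t ht ht₁ ht₂ htη
  rw [norm_smul, Real.norm_of_nonneg (Real.rpow_nonneg ht.1.le _),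
    Real.norm_of_nonneg (weightedNorm_nonneg μ t _)]
  refine (rpow_mul_norm_frozenRHS_sub_le hA hF ⟨hx, ?_⟩ ⟨hV₁ t ht, ht₁.2.trans_lt hηr⟩
    ⟨hV₂ t ht, ht₂.2.trans_lt hηr⟩ ht.1 htη ht₁ ht₂).trans
      (mul_le_mul_of_nonneg_right hηc (weightedNorm_nonneg μ t _))
  rwa [sub_self, interpNorm_zero]

theorem SingularStructure.isLittleO (hF₂ : SingularStructure i μ β V F₂) (hμ : 0 < μ)
    (hμβ : μ < β) (hβ1 : β < 1) (hT : 0 < T) (hx : x ∈ V) (h₁ : IsPrimitive i μ T x v₁ g₁)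
    (h₂ : IsPrimitive i μ T x v₂ g₂) (hV₁ : ∀ t ∈ Ioc 0 T, i (v₁ t) ∈ V)
    (hV₂ : ∀ t ∈ Ioc 0 T, i (v₂ t) ∈ V) :
    (fun t => t ^ (1 - μ) • (F₂ (i (v₁ t)) - F₂ (i (v₂ t)))) =o[𝓝[>] 0]
        fun t => weightedNorm i μ t (v₁ t - v₂ t) := by
  have hμ1 := hμβ.trans hβ1
  obtain ⟨m, b, ρ, hbρ, hF⟩ := hF₂
  obtain ⟨K, hK, hF⟩ := hF x hx 1 one_pos
  set S : ℝ → ℝ := fun t => ∑ j, (t ^ (1 - b j) +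
    t ^ (1 - b j) * interpNorm i β (i (v₁ t)) ^ ρ j +
    t ^ (1 - b j) * interpNorm i β (i (v₂ t)) ^ ρ j)
  have hS : Tendsto (fun t => K * S t) (𝓝[>] 0) (𝓝 0) := by
    have hsum : Tendsto S (𝓝[>] 0) (𝓝 (∑ j : Fin m, (0 + 0 + 0))) := by
      refine tendsto_finsetSum _ fun j _ => ?_
      obtain ⟨⟨-, hbβ⟩, hρ, hρb⟩ := hbρ j
      rw [div_le_one (sub_pos.2 hμ1)] at hρb
      have hb1 : b j < 1 := hbβ.trans_lt hβ1
      exact ((tendsto_rpow_nhdsGT_zero (sub_pos.2 hb1)).add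
        (tendsto_rpow_mul_rpow (fun _ => interpNorm_nonneg _ _ _)
          (h₁.tendsto_rpow_mul_interpNorm hμ hμβ hβ1 hT) hb1 hρ hρb)).add
        (tendsto_rpow_mul_rpow (fun _ => interpNorm_nonneg _ _ _)
          (h₂.tendsto_rpow_mul_interpNorm hμ hμβ hβ1 hT) hb1 hρ hρb)
    simpa using hsum.const_mul K
  refine isLittleO_iff.2 fun c hc => ?_
  filter_upwards [Ioc_mem_nhdsGT hT, h₁.eventually_inTube hμ hμ1 hT one_pos,
    h₂.eventually_inTube hμ hμ1 hT one_pos, hS.eventually_le_const hc] with t ht ht₁ ht₂ hSt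
  have hW := weightedNorm_nonneg (i := i) μ t (v₁ t - v₂ t)
  have hdiff := hF _ ⟨⟨apply_mem_interpSpace hμ1 _, ht₁.2⟩, hV₁ t ht, apply_mem_interpSpace hβ1 _⟩
    _ ⟨⟨apply_mem_interpSpace hμ1 _, ht₂.2⟩, hV₂ t ht, apply_mem_interpSpace hβ1 _⟩
  have hpt : 0 ≤ t ^ (1 - μ) := Real.rpow_nonneg ht.1.le _
  rw [norm_smul, Real.norm_of_nonneg hpt, Real.norm_of_nonneg hW]
  refine (mul_le_mul_of_nonneg_left hdiff hpt).trans
    (le_trans ?_ (mul_le_mul_of_nonneg_right hSt hW))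
  rw [mul_left_comm, mul_assoc, Finset.mul_sum, Finset.sum_mul]
  refine mul_le_mul_of_nonneg_left (Finset.sum_le_sum fun j _ => ?_) hK.le
  obtain ⟨⟨hμb, hbβ⟩, -, -⟩ := hbρ j
  have hweight := rpow_mul_interpNorm_apply_le (i := i) hμ.le hμ1 hμb (hbβ.trans hβ1.le) ht.1
    (v₁ t - v₂ t)
  have hv₁ := Real.rpow_nonneg (interpNorm_nonneg i β (i (v₁ t))) (ρ j)
  have hv₂ := Real.rpow_nonneg (interpNorm_nonneg i β (i (v₂ t))) (ρ j)
  rw [map_sub] at hweight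
  linarith [mul_le_mul_of_nonneg_left hweight (add_nonneg (add_nonneg zero_le_one hv₁) hv₂)]

variable [CompleteSpace E₀]

theorem isSolution_iff (hν : 0 < ν) (hT : 0 < T) (B : E₁ →L[ℝ] E₀) :
    IsSolution i ν T V A F₁ F₂ x v ↔ x ∈ V ∧ (∀ t ∈ Ioc 0 T, i (v t) ∈ V) ∧
      IsPrimitive i ν T x v fun t => frozenRHS i B A (F₁ + F₂) (v t) - B (v t) := by
  have hfrozen : ∀ a : E₁, frozenRHS i B A (F₁ + F₂) a - B a =
      F₁ (i a) + F₂ (i a) - A (i a) a := fun a => by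
    simp only [frozenRHS, _root_.sub_apply, Pi.add_apply]
    abel
  simp only [hfrozen]
  constructor
  · rintro ⟨hv, hx, htrace, heq⟩
    exact ⟨hx, fun t ht => (heq t ht).1, (hv.isPrimitive hν htrace).congr hT (fun _ _ => rfl)
      fun t ht => (eq_sub_of_add_eq (heq t ht).2).symm⟩
  · exact fun ⟨hx, hV, hv⟩ => ⟨hv.memE1 hν hT, hx, hv.hasTrace hν hT, fun t ht =>
      ⟨hV t ht, by rw [hv.timeDeriv_eq hν ht, sub_add_cancel]⟩⟩

namespace IsSolution

theorem mono_right (hν : 0 < ν) (h : IsSolution i ν T V A F₁ F₂ x v) {T' : ℝ}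
    (hT' : 0 < T') (hTT' : T' ≤ T) : IsSolution i ν T' V A F₁ F₂ x v := by
  obtain ⟨hx, hV, hv⟩ := (isSolution_iff hν (hT'.trans_le hTT') 0).1 h
  exact (isSolution_iff hν hT' 0).2
    ⟨hx, fun t ht => hV t ⟨ht.1, ht.2.trans hTT'⟩, hv.mono_right hTT'⟩

theorem anti_weight (hμ : 0 < μ) (hμν : μ ≤ ν) (hT : 0 < T)
    (h : IsSolution i ν T V A F₁ F₂ x v) : IsSolution i μ T V A F₁ F₂ x v := by
  obtain ⟨hx, hV, hv⟩ := (isSolution_iff (hμ.trans_le hμν) hT 0).1 h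
  exact (isSolution_iff hμ hT 0).2 ⟨hx, hV, hv.anti_weight hμν⟩

theorem shift (hν : 0 < ν) (hν1 : ν < 1) (h : IsSolution i ν T V A F₁ F₂ x v) {s : ℝ}
    (hs : 0 < s) (hsT : s < T) :
    IsSolution i ν (T - s) V A F₁ F₂ (i (v s)) (fun t => v (t + s)) := by
  obtain ⟨-, hV, hv⟩ := (isSolution_iff hν (hs.trans hsT) 0).1 h
  exact (isSolution_iff hν (sub_pos.2 hsT) 0).2 ⟨hV s ⟨hs, hsT.le⟩,
    fun t ht => hV (t + s) ⟨by linarith [ht.1], by linarith [ht.2]⟩, hv.shift hν hν1 hs hsT⟩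

theorem of_eventuallyEq (hμ : 0 < μ) (hν : 0 < ν) {τ : ℝ} (hτ : 0 < τ) (hT : 0 < T)
    (h₁ : IsSolution i μ T V A F₁ F₂ x v₁) (h₂ : IsSolution i ν τ V A F₁ F₂ x v₂)
    (h : v₁ =ᶠ[𝓝[>] 0] v₂) : IsSolution i ν T V A F₁ F₂ x v₁ := by
  obtain ⟨hx, hV, hv₁⟩ := (isSolution_iff hμ hT 0).1 h₁
  obtain ⟨-, -, hv₂⟩ := (isSolution_iff hν hτ 0).1 h₂
  refine (isSolution_iff hν hT 0).2 ⟨hx, hV, memBC_of_tendsto hv₁.memBC.continuousOn ?_,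
    memBC_of_tendsto hv₁.memBC_deriv.continuousOn ?_, hv₁.integral_eq⟩
  · exact hv₂.memBC.tendsto_zero.congr' (h.mono fun t ht => by simp only [ht])
  · exact hv₂.memBC_deriv.tendsto_zero.congr' (h.mono fun t ht => by simp only [ht])

variable [CompleteSpace E₁]

theorem exists_eqOn (hi : Function.Injective i) (hμ : 0 < μ) (hμβ : μ < β) (hβ1 : β < 1)
    (hAF₁ : LocLipCoefficients i μ V A F₁) (hF₂ : SingularStructure i μ β V F₂)
    (hT : 0 < T) (h₁ : IsSolution i μ T V A F₁ F₂ x v₁)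
    (h₂ : IsSolution i μ T V A F₁ F₂ x v₂) : ∃ δ ∈ Ioc 0 T, EqOn v₁ v₂ (Ioc 0 δ) := by
  have hμ1 := hμβ.trans hβ1
  obtain ⟨hx, hV₁, hv₁⟩ := (isSolution_iff hμ hT (A x)).1 h₁
  obtain ⟨-, hV₂, hv₂⟩ := (isSolution_iff hμ hT (A x)).1 h₂
  obtain ⟨T₀, hT₀, C, hC, hlin⟩ := exists_hasMaxRegBound hi hμ le_rfl hμ1 (hAF₁.1 x hx)
  set f : ℝ → E₀ := fun t => frozenRHS i (A x) A (F₁ + F₂) (v₁ t) -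
    frozenRHS i (A x) A (F₁ + F₂) (v₂ t) with hf_def
  have hlittleO : (fun t => t ^ (1 - μ) • f t) =o[𝓝[>] 0]
      fun t => weightedNorm i μ t (v₁ t - v₂ t) := by
    refine ((hAF₁.isLittleO hμ hμ1 hT hx hv₁ hv₂ hV₁ hV₂).add
      (hF₂.isLittleO hμ hμβ hβ1 hT hx hv₁ hv₂ hV₁ hV₂)).congr_left fun t => ?_
    simp only [hf_def, frozenRHS, Pi.add_apply, ← smul_add]
    congr 1
    abel
  obtain ⟨δ, hδ, hδf⟩ := (eventually_nhdsGT_zero_iff (lt_min hT hT₀)).1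
    (hlittleO.def (c := 1 / (2 * C)) (by positivity))
  have hδT : δ ≤ T := hδ.2.trans (min_le_left _ _)
  have hlin := hlin δ ⟨hδ.1, hδ.2.trans (min_le_right _ _)⟩
  have hw : IsPrimitive i μ δ 0 (fun t => v₁ t - v₂ t) fun t => f t - A x (v₁ t - v₂ t) := by
    have hsub := (hv₁.sub hμ hv₂).mono_right hδT
    rw [sub_self] at hsub
    exact hsub.congr hδ.1 (fun _ _ => rfl) fun t _ => by simp only [hf_def, map_sub]; abel
  have hf : MemBC μ δ f := (hw.memBC_deriv.add (hw.memBC.clm (A x))).congr hδ.1 fun t _ =>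
    (sub_add_cancel (f t) (A x (v₁ t - v₂ t))).symm
  have hbound : ∀ M, WeightLE μ δ M f → ∀ t ∈ Ioc 0 δ,
      weightedNorm i μ t (v₁ t - v₂ t) ≤ C * M := fun M hM t ht => by
    simpa [interpNorm_zero] using hlin.weightedNorm_le hf hw hM t ht
  have hf0 : WeightLE μ δ 0 f := by
    obtain ⟨N, hN⟩ := hf.bounded
    refine WeightLE.of_forall_half hN fun M hM t ht => ?_
    have hft := hδf t ht
    rw [norm_smul, Real.norm_of_nonneg (Real.rpow_nonneg ht.1.le _),
      Real.norm_of_nonneg (weightedNorm_nonneg μ t _)] at hft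
    calc t ^ (1 - μ) * ‖f t‖ ≤ 1 / (2 * C) * (C * M) :=
          hft.trans (mul_le_mul_of_nonneg_left (hbound M hM t ht) (by positivity))
      _ = (M + 0) / 2 := by field_simp; ring
  refine ⟨δ, ⟨hδ.1, hδT⟩, eqOn_of_weightLE_zero (μ := μ) fun t ht =>
    (rpow_mul_norm_le_weightedNorm (i := i) μ t _).trans ?_⟩
  simpa using hbound 0 hf0 t ht

theorem eqOn (hi : Function.Injective i) (hμ : 0 < μ) (hμβ : μ < β) (hβ1 : β < 1)
    (hAF₁ : LocLipCoefficients i μ V A F₁) (hF₂ : SingularStructure i μ β V F₂)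
    (hT : 0 < T) (h₁ : IsSolution i μ T V A F₁ F₂ x v₁)
    (h₂ : IsSolution i μ T V A F₁ F₂ x v₂) : EqOn v₁ v₂ (Ioc 0 T) := by
  have hμ1 := hμβ.trans hβ1
  obtain ⟨δ, ⟨hδ, -⟩, hloc⟩ := h₁.exists_eqOn hi hμ hμβ hβ1 hAF₁ hF₂ hT h₂
  have hsub : Icc δ T ⊆ Ioc 0 T := fun t ht => ⟨hδ.trans_le ht.1, ht.2⟩
  have hclosed : IsClosed ({t | v₁ t = v₂ t} ∩ Icc δ T) := by
    have hcont : ContinuousOn (fun t => v₁ t - v₂ t) (Icc δ T) :=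
      (h₁.1.memBC_one.continuousOn.sub h₂.1.memBC_one.continuousOn).mono hsub
    convert hcont.preimage_isClosed_of_isClosed isClosed_Icc (isClosed_singleton (x := (0 : E₁)))
      using 1
    ext t
    simp [sub_eq_zero, and_comm]
  have hIcc := hclosed.Icc_subset_of_forall_mem_nhdsWithin (hloc ⟨hδ, le_rfl⟩) fun s hs => by
    have hs0 : 0 < s := hδ.trans_le hs.2.1
    have hs₂ := h₂.shift hμ hμ1 hs0 hs.2.2
    rw [← show v₁ s = v₂ s from hs.1] at hs₂
    obtain ⟨η, hη, heq⟩ := (h₁.shift hμ hμ1 hs0 hs.2.2).exists_eqOn hi hμ hμβ hβ1 hAF₁ hF₂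
      (sub_pos.2 hs.2.2) hs₂
    filter_upwards [Ioc_mem_nhdsGT (lt_add_of_pos_right s hη.1)] with t ht
    simpa using heq (show t - s ∈ Ioc 0 η from ⟨by linarith [ht.1], by linarith [ht.2]⟩)
  intro t ht
  rcases le_total t δ with h | h
  · exact hloc ⟨ht.1, h⟩
  · exact hIcc ⟨h, ht.2⟩

end IsSolution

end Uniqueness

section Existence

open scoped NNReal

variable {E₀ E₁ : Type*} [NormedAddCommGroup E₀] [NormedSpace ℝ E₀]
  [NormedAddCommGroup E₁] [NormedSpace ℝ E₁]
  {i : E₁ →L[ℝ] E₀} {μ ν β T C D M N τ ε r t η d : ℝ} {L : ℝ≥0} {V : Set E₀}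
  {A : E₀ → E₁ →L[ℝ] E₀} {B : E₁ →L[ℝ] E₀} {F F₁ F₂ : E₀ → E₀} {x x₀ x₁ x₂ : E₀} {a b : E₁}
  {v v₁ v₂ : ℝ → E₁} {f f₁ f₂ g : ℝ → E₀}

theorem closedBallInterp_mono (h : ε ≤ r) : closedBallInterp i ν x₀ ε ⊆ closedBallInterp i ν x₀ r :=
  fun _ hy => ⟨hy.1, hy.2.trans h⟩

theorem exists_interpLipschitzOn_closedBall (hμ : 0 ≤ μ) (hμβ : μ ≤ β) (hβν : β ≤ ν)
    (hV : IsOpenInterp i μ V) (hAF₁ : LocLipCoefficients i μ V A F₁)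
    (hF₂ : SingularStructure i μ β V F₂) (hx₀ : x₀ ∈ V ∩ interpSpace i ν) :
    ∃ r > 0, ∃ L : ℝ≥0, closedBallInterp i ν x₀ r ⊆ V ∧
      InterpLipschitzOn i ν L (closedBallInterp i ν x₀ r) A ∧
      InterpLipschitzOn i ν L (closedBallInterp i ν x₀ r) (F₁ + F₂) := by
  obtain ⟨hxV, hxν⟩ := hx₀
  have hμν := hμβ.trans hβν
  obtain ⟨r₁, hr₁, hball⟩ := hV.2 x₀ hxV
  obtain ⟨r₂, hr₂, L₁, hA, hF⟩ := hAF₁.exists_interpLipschitzOn hxV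
  have hm : 0 < min r₁ r₂ := lt_min hr₁ hr₂
  set r := min r₁ r₂ / (2 * (1 + ‖i‖))
  have hr : 0 < r := by positivity
  have hclose : ∀ y ∈ closedBallInterp i ν x₀ r, interpNorm i μ (y - x₀) < min r₁ r₂ :=
    fun y hy => calc interpNorm i μ (y - x₀) ≤ (1 + ‖i‖) * interpNorm i ν (y - x₀) :=
          interpNorm_le_mul_of_le hμ hμν (sub_mem_interpSpace hy.1 hxν)
      _ ≤ (1 + ‖i‖) * r := by gcongr; exact hy.2
      _ = min r₁ r₂ / 2 := by simp only [r]; field_simp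
      _ < min r₁ r₂ := half_lt_self hm
  have hmemV : closedBallInterp i ν x₀ r ⊆ V := fun y hy =>
    hball y (interpSpace_anti hμν hy.1) ((hclose y hy).trans_le (min_le_left _ _))
  have hsubν : closedBallInterp i ν x₀ r ⊆ interpSpace i ν := fun _ hy => hy.1
  obtain ⟨L₂, hF₂⟩ := hF₂.exists_interpLipschitzOn hμ hμβ hβν hxV hm
    (fun y hy => ⟨⟨interpSpace_anti hμν hy.1, (hclose y hy).le⟩, hmemV hy⟩) hsubν
    fun y hy => (interpNorm_le_sub_add (hμ.trans hμν) hy.1 hxν).trans (add_le_add_left hy.2 _)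
  have hsub : closedBallInterp i ν x₀ r ⊆ {y ∈ V | interpNorm i μ (y - x₀) < r₂} :=
    fun y hy => ⟨hmemV hy, (hclose y hy).trans_le (min_le_right _ _)⟩
  exact ⟨r, hr, L₁ * (1 + ‖i‖₊) + L₂, hmemV,
    ((hA.mono le_rfl hsub).of_weight_le hμ hμν hsubν).mono (le_add_of_nonneg_right L₂.2)
      subset_rfl,
    ((hF.mono le_rfl hsub).of_weight_le hμ hμν hsubν).add hF₂⟩

theorem HasMaxRegBound.weightedNorm_sub_le (hB : HasMaxRegBound i ν T C B) (hν : 0 < ν)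
    (hT : 0 < T) (hf₁ : MemBC ν T f₁) (hf₂ : MemBC ν T f₂)
    (h₁ : IsPrimitive i ν T x₁ v₁ fun t => f₁ t - B (v₁ t))
    (h₂ : IsPrimitive i ν T x₂ v₂ fun t => f₂ t - B (v₂ t))
    (hM : WeightLE ν T M fun t => f₁ t - f₂ t) (ht : t ∈ Ioc 0 T) :
    weightedNorm i ν t (v₁ t - v₂ t) ≤ C * (M + interpNorm i ν (x₁ - x₂)) := by
  refine hB.weightedNorm_le (hf₁.sub hf₂) ((h₁.sub hν h₂).congr hT (fun _ _ => rfl) fun t _ => ?_)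
    hM t ht
  simp only [map_sub]
  abel

theorem InTube.of_weightedNorm_sub_le (hν : 0 ≤ ν) (hν1 : ν < 1) (hx : x ∈ interpSpace i ν)
    (ht : 0 < t) (hb : InTube i ν x η t b) (hab : weightedNorm i ν t (a - b) ≤ d) :
    InTube i ν x (d + η) t a := by
  constructor
  · calc t ^ (1 - ν) * ‖a‖ = t ^ (1 - ν) * ‖(a - b) + b‖ := by rw [sub_add_cancel]
      _ ≤ t ^ (1 - ν) * ‖a - b‖ + t ^ (1 - ν) * ‖b‖ := rpow_mul_norm_add_le ht.le _ _ _
      _ ≤ d + η := add_le_add ((rpow_mul_norm_le_weightedNorm (i := i) ν t _).trans hab) hb.1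
  · have hdiff : interpNorm i ν (i a - i b) ≤ d := by
      rw [← map_sub]
      exact (interpNorm_le_weightedNorm ν t _).trans hab
    exact (interpNorm_sub_le_sub_add_sub hν (apply_mem_interpSpace hν1 a)
      (apply_mem_interpSpace hν1 b) hx).trans (add_le_add hdiff hb.2)

theorem IsPrimitive.normE1_le [CompleteSpace E₀] (hν : 0 < ν) (hT : 0 < T)
    (H : IsPrimitive i ν T x v g) (hv : WeightLE ν T M v) (hg : WeightLE ν T N g) :
    normE1 i ν T v ≤ N + M := by
  have : Nonempty (Ioc (0 : ℝ) T) := ⟨⟨T, hT, le_rfl⟩⟩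
  refine ciSup_le fun ⟨t, ht⟩ => ?_
  rw [H.timeDeriv_eq hν ht, mul_add]
  exact add_le_add (hg t ht) (hv t ht)

/-- Smallness conditions under which `f ↦ frozenRHS ∘ v`, with `v` the solution of
`v' + A(x₀) v = f`, `v(0) = x`, maps the `ε`-ball of `BC_{1-ν}([0,τ], E₀)` into itself and is a
`1/2`-contraction there, for every `x` with `|x - x₀|_{E_ν} ≤ ε`. The functions `v` occurring stay
in the tube of radius `3 C ε` around `x₀`. -/
structure IsContractionRegime (i : E₁ →L[ℝ] E₀) (ν : ℝ) (A : E₀ → E₁ →L[ℝ] E₀) (F : E₀ → E₀)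
    (x₀ : E₀) (C τ ε : ℝ) (L : ℝ≥0) : Prop where
  time_pos : 0 < τ
  radius_pos : 0 < ε
  hasMaxRegBound : HasMaxRegBound i ν τ C (A x₀)
  lipschitz_operator : InterpLipschitzOn i ν L (closedBallInterp i ν x₀ (3 * C * ε)) A
  lipschitz_force : InterpLipschitzOn i ν L (closedBallInterp i ν x₀ (3 * C * ε)) F
  contraction : 3 * L * (3 * C * ε) * C ≤ 1 / 2
  exists_reference : ∃ v, IsPrimitive i ν τ x₀ v (fun t => 0 - A x₀ (v t)) ∧
    ∀ t ∈ Ioc 0 τ, InTube i ν x₀ (C * ε) t (v t)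
  rpow_le : ∀ t ∈ Ioc 0 τ, t ^ (1 - ν) ≤ 3 * C * ε
  rpow_mul_le : ∀ t ∈ Ioc 0 τ, t ^ (1 - ν) * (L * (3 * C * ε) + ‖F x₀‖) ≤ ε / 2

namespace IsContractionRegime

theorem mem_interpSpace (H : IsContractionRegime i ν A F x₀ C τ ε L) (hν : 0 < ν) :
    x₀ ∈ interpSpace i ν :=
  let ⟨_, hv, _⟩ := H.exists_reference
  hv.mem_interpSpace hν H.time_pos

theorem tube_radius_pos (H : IsContractionRegime i ν A F x₀ C τ ε L) : 0 < 3 * C * ε :=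
  (Real.rpow_pos_of_pos H.time_pos _).trans_le (H.rpow_le τ ⟨H.time_pos, le_rfl⟩)

theorem bound_pos (H : IsContractionRegime i ν A F x₀ C τ ε L) : 0 < C := by
  have hpos := H.tube_radius_pos
  rw [mul_right_comm] at hpos
  exact pos_of_mul_pos_right hpos (by linarith [H.radius_pos])

theorem center_mem (H : IsContractionRegime i ν A F x₀ C τ ε L) (hν : 0 < ν) :
    x₀ ∈ closedBallInterp i ν x₀ (3 * C * ε) :=
  ⟨H.mem_interpSpace hν, by rw [sub_self, interpNorm_zero]; exact H.tube_radius_pos.le⟩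

theorem inTube (H : IsContractionRegime i ν A F x₀ C τ ε L)
    (hν : 0 < ν) (hν1 : ν < 1) (hx : x ∈ closedBallInterp i ν x₀ ε) (hf : MemBC ν τ f)
    (hfε : WeightLE ν τ ε f)
    (hv : IsPrimitive i ν τ x v fun t => f t - A x₀ (v t)) (ht : t ∈ Ioc 0 τ) :
    InTube i ν x₀ (3 * C * ε) t (v t) := by
  obtain ⟨v₀, hv₀, htube⟩ := H.exists_reference
  have hC := H.bound_pos
  have hsub : weightedNorm i ν t (v t - v₀ t) ≤ C * (ε + ε) :=
    (H.hasMaxRegBound.weightedNorm_sub_le hν H.time_pos hf .zero hv hv₀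
      (hfε.congr fun t _ => sub_zero (f t)) ht).trans (by gcongr; exact hx.2)
  convert (htube t ht).of_weightedNorm_sub_le hν.le hν1 (H.mem_interpSpace hν) ht.1 hsub using 1
  ring

theorem memBC_frozenRHS (H : IsContractionRegime i ν A F x₀ C τ ε L)
    (hν : 0 < ν) (hν1 : ν < 1) (hv : MemBC ν τ v)
    (htube : ∀ t ∈ Ioc 0 τ, InTube i ν x₀ (3 * C * ε) t (v t)) :
    MemBC ν τ fun t => frozenRHS i (A x₀) A F (v t) := by
  have hball : ∀ t ∈ Ioc 0 τ, i (v t) ∈ closedBallInterp i ν x₀ (3 * C * ε) := fun t ht =>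
    ⟨apply_mem_interpSpace hν1 _, (htube t ht).2⟩
  have hcont : ContinuousOn (fun t => frozenRHS i (A x₀) A F (v t)) (Ioc 0 τ) :=
    ((continuousOn_const.sub (H.lipschitz_operator.continuousOn_comp hν.le hν1.le
      hv.continuousOn hball)).clm_apply hv.continuousOn).add
      (H.lipschitz_force.continuousOn_comp hν.le hν1.le hv.continuousOn hball)
  have hlim : Tendsto (fun t : ℝ => L * (3 * C * ε) * (t ^ (1 - ν) * ‖v t‖) +
      t ^ (1 - ν) * (L * (3 * C * ε) + ‖F x₀‖)) (𝓝[>] 0) (𝓝 0) := by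
    simpa using (hv.tendsto_zero.const_mul _).add
      ((tendsto_rpow_nhdsGT_zero (sub_pos.2 hν1)).mul_const _)
  refine memBC_of_eventually_le hcont fun c hc => ?_
  filter_upwards [Ioc_mem_nhdsGT H.time_pos, hlim.eventually_le_const hc] with t ht htc
  exact (rpow_mul_norm_frozenRHS_le H.lipschitz_operator H.lipschitz_force (H.center_mem hν)
    (hball t ht) ht.1 (htube t ht).2).trans htc

theorem weightLE_frozenRHS (H : IsContractionRegime i ν A F x₀ C τ ε L) (hν : 0 < ν) (hν1 : ν < 1)
    (htube : ∀ t ∈ Ioc 0 τ, InTube i ν x₀ (3 * C * ε) t (v t)) :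
    WeightLE ν τ ε fun t => frozenRHS i (A x₀) A F (v t) := fun t ht => by
  have hC := H.bound_pos
  have hε := H.radius_pos
  calc t ^ (1 - ν) * ‖frozenRHS i (A x₀) A F (v t)‖
      ≤ L * (3 * C * ε) * (t ^ (1 - ν) * ‖v t‖) + t ^ (1 - ν) * (L * (3 * C * ε) + ‖F x₀‖) :=
        rpow_mul_norm_frozenRHS_le H.lipschitz_operator H.lipschitz_force (H.center_mem hν)
          ⟨apply_mem_interpSpace hν1 _, (htube t ht).2⟩ ht.1 (htube t ht).2
    _ ≤ L * (3 * C * ε) * (3 * C * ε) + ε / 2 := by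
        gcongr L * (3 * C * ε) * ?_ + ?_
        exacts [(htube t ht).1, H.rpow_mul_le t ht]
    _ ≤ ε := by linarith [mul_le_mul_of_nonneg_right H.contraction H.radius_pos.le]

theorem weightLE_frozenRHS_sub (H : IsContractionRegime i ν A F x₀ C τ ε L)
    (hν : 0 < ν) (hν1 : ν < 1)
    (h₁ : ∀ t ∈ Ioc 0 τ, InTube i ν x₀ (3 * C * ε) t (v₁ t))
    (h₂ : ∀ t ∈ Ioc 0 τ, InTube i ν x₀ (3 * C * ε) t (v₂ t))
    (hD : ∀ t ∈ Ioc 0 τ, weightedNorm i ν t (v₁ t - v₂ t) ≤ C * D) :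
    WeightLE ν τ (D / 2) fun t =>
      frozenRHS i (A x₀) A F (v₁ t) - frozenRHS i (A x₀) A F (v₂ t) := fun t ht => by
  have hη := H.tube_radius_pos.le
  refine (rpow_mul_norm_frozenRHS_sub_le H.lipschitz_operator H.lipschitz_force (H.center_mem hν)
    ⟨apply_mem_interpSpace hν1 _, (h₁ t ht).2⟩ ⟨apply_mem_interpSpace hν1 _, (h₂ t ht).2⟩ ht.1
    (H.rpow_le t ht) (h₁ t ht) (h₂ t ht)).trans ?_
  have hC := H.bound_pos
  have hD0 : 0 ≤ D := nonneg_of_mul_nonneg_right ((weightedNorm_nonneg ν t _).trans (hD t ht)) hC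
  calc 3 * L * (3 * C * ε) * weightedNorm i ν t (v₁ t - v₂ t)
      ≤ 3 * L * (3 * C * ε) * (C * D) := by gcongr; exact hD t ht
    _ ≤ D / 2 := by linarith [mul_le_mul_of_nonneg_right H.contraction hD0]

theorem exists_isPrimitive [CompleteSpace E₀] (H : IsContractionRegime i ν A F x₀ C τ ε L)
    (hν : 0 < ν) (hν1 : ν < 1) (hx : x ∈ closedBallInterp i ν x₀ ε) :
    ∃ v, IsPrimitive i ν τ x v (fun t => frozenRHS i (A x₀) A F (v t) - A x₀ (v t)) ∧
      ∀ t ∈ Ioc 0 τ, InTube i ν x₀ (3 * C * ε) t (v t) := by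
  choose! sol hsol using fun f hf => H.hasMaxRegBound.exists_isPrimitive f hf x hx.1
  have htube : ∀ f, MemBC ν τ f → WeightLE ν τ ε f → ∀ t ∈ Ioc 0 τ,
      InTube i ν x₀ (3 * C * ε) t (sol f t) := fun f hf hfε t ht =>
    H.inTube hν hν1 hx hf hfε (hsol f hf) ht
  obtain ⟨f, hf, hfε, hfix⟩ := exists_eqOn_of_contraction H.time_pos H.radius_pos.le
    (Φ := fun f t => frozenRHS i (A x₀) A F (sol f t))
    (fun f hf hfε => ⟨H.memBC_frozenRHS hν hν1 (hsol f hf).memBC (htube f hf hfε),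
      H.weightLE_frozenRHS hν hν1 (htube f hf hfε)⟩)
    fun f g hf hfε hg hgε M hM => H.weightLE_frozenRHS_sub hν hν1 (htube f hf hfε)
      (htube g hg hgε) fun t ht => by
        simpa [interpNorm_zero] using H.hasMaxRegBound.weightedNorm_sub_le hν H.time_pos hf hg
          (hsol f hf) (hsol g hg) hM ht
  exact ⟨sol f, (hsol f hf).congr H.time_pos (fun _ _ => rfl) fun t ht => by
    simp only [← hfix ht], htube f hf hfε⟩

theorem normE1_sub_le [CompleteSpace E₀] (H : IsContractionRegime i ν A F x₀ C τ ε L)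
    (hν : 0 < ν) (hν1 : ν < 1)
    (h₁ : IsPrimitive i ν τ x₁ v₁ fun t => frozenRHS i (A x₀) A F (v₁ t) - A x₀ (v₁ t))
    (h₂ : IsPrimitive i ν τ x₂ v₂ fun t => frozenRHS i (A x₀) A F (v₂ t) - A x₀ (v₂ t))
    (htube₁ : ∀ t ∈ Ioc 0 τ, InTube i ν x₀ (3 * C * ε) t (v₁ t))
    (htube₂ : ∀ t ∈ Ioc 0 τ, InTube i ν x₀ (3 * C * ε) t (v₂ t)) :
    normE1 i ν τ (v₁ - v₂) ≤
      (1 + (1 + ‖A x₀‖) * (2 * C)) * interpNorm i ν (x₁ - x₂) := by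
  have hf₁ := H.memBC_frozenRHS hν hν1 h₁.memBC htube₁
  have hf₂ := H.memBC_frozenRHS hν hν1 h₂.memBC htube₂
  have hlin : ∀ M, WeightLE ν τ M (fun t =>
      frozenRHS i (A x₀) A F (v₁ t) - frozenRHS i (A x₀) A F (v₂ t)) → ∀ t ∈ Ioc 0 τ,
        weightedNorm i ν t (v₁ t - v₂ t) ≤ C * (M + interpNorm i ν (x₁ - x₂)) :=
    fun M hM t ht => H.hasMaxRegBound.weightedNorm_sub_le hν H.time_pos hf₁ hf₂ h₁ h₂ hM ht
  have hf : WeightLE ν τ (interpNorm i ν (x₁ - x₂)) fun t =>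
      frozenRHS i (A x₀) A F (v₁ t) - frozenRHS i (A x₀) A F (v₂ t) := by
    obtain ⟨N, hN⟩ := (hf₁.sub hf₂).bounded
    exact WeightLE.of_forall_half hN fun M hM =>
      H.weightLE_frozenRHS_sub hν hν1 htube₁ htube₂ (hlin M hM)
  have hv : WeightLE ν τ (2 * C * interpNorm i ν (x₁ - x₂)) fun t => v₁ t - v₂ t := fun t ht =>
    (rpow_mul_norm_le_weightedNorm (i := i) ν t _).trans ((hlin _ hf t ht).trans_eq (by ring))
  have hsub := (h₁.sub hν h₂).normE1_le hν H.time_pos hv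
    ((hf.sub (hv.clm (A x₀))).congr fun t _ => by simp only [map_sub]; abel)
  exact hsub.trans_eq (by ring)

end IsContractionRegime

theorem exists_isContractionRegime (hν : 0 < ν) (hν1 : ν < 1) (hT : 0 < T) (hC : 0 < C)
    (hlin : ∀ δ ∈ Ioc 0 T, HasMaxRegBound i ν δ C (A x₀)) (hx₀ : x₀ ∈ interpSpace i ν)
    (hr : 0 < r) (hA : InterpLipschitzOn i ν L (closedBallInterp i ν x₀ r) A)
    (hF : InterpLipschitzOn i ν L (closedBallInterp i ν x₀ r) F) :
    ∃ τ ε, ε ≤ r ∧ 3 * C * ε ≤ r ∧ IsContractionRegime i ν A F x₀ C τ ε L := by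
  obtain ⟨ε, hε, hεr, hεL⟩ : ∃ ε > 0, (3 * C + 1) * ε ≤ r ∧ (18 * L * C ^ 2 + 1) * ε ≤ 1 := by
    refine ⟨min (r / (3 * C + 1)) (1 / (18 * L * C ^ 2 + 1)), by positivity, ?_, ?_⟩
    · exact (le_div_iff₀' (by positivity)).1 (min_le_left _ _)
    · exact (le_div_iff₀' (by positivity)).1 (min_le_right _ _)
  have hCε : 0 < C * ε := by positivity
  obtain ⟨v₀, hv₀⟩ := (hlin T ⟨hT, le_rfl⟩).exists_isPrimitive _ .zero x₀ hx₀
  have hrpow := tendsto_rpow_nhdsGT_zero (sub_pos.2 hν1)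
  have hforce : Tendsto (fun t : ℝ => t ^ (1 - ν) * (L * (3 * C * ε) + ‖F x₀‖)) (𝓝[>] 0) (𝓝 0) := by
    simpa using hrpow.mul_const (L * (3 * C * ε) + ‖F x₀‖)
  obtain ⟨τ, hτ, hsmall⟩ := (eventually_nhdsGT_zero_iff hT).1
    ((hv₀.eventually_inTube hν hν1 hT hCε).and
      ((hrpow.eventually_le_const (show 0 < 3 * C * ε by positivity)).and
        (hforce.eventually_le_const (half_pos hε))))
  have hball : closedBallInterp i ν x₀ (3 * C * ε) ⊆ closedBallInterp i ν x₀ r :=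
    closedBallInterp_mono (by linarith)
  exact ⟨τ, ε, by linarith, by linarith,
    { time_pos := hτ.1
      radius_pos := hε
      hasMaxRegBound := hlin τ hτ
      lipschitz_operator := hA.mono le_rfl hball
      lipschitz_force := hF.mono le_rfl hball
      contraction := by linarith
      exists_reference := ⟨v₀, hv₀.mono_right hτ.2, fun t ht => (hsmall t ht).1⟩
      rpow_le := fun t ht => (hsmall t ht).2.1
      rpow_mul_le := fun t ht => (hsmall t ht).2.2 }⟩

theorem exists_lipschitz_solutionMap [CompleteSpace E₀] [CompleteSpace E₁]
    (hi : Function.Injective i) (hμ : 0 < μ) (hμβ : μ ≤ β) (hβν : β ≤ ν) (hν1 : ν < 1)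
    (hV : IsOpenInterp i μ V) (hAF₁ : LocLipCoefficients i μ V A F₁)
    (hF₂ : SingularStructure i μ β V F₂) (hx₀ : x₀ ∈ V ∩ interpSpace i ν) :
    ∃ τ > 0, ∃ ε > 0, ∃ σ > 0, ∃ u : E₀ → ℝ → E₁,
      (∀ x ∈ closedBallInterp i ν x₀ ε, IsSolution i ν τ V A F₁ F₂ x (u x)) ∧
      ∀ x₁ ∈ closedBallInterp i ν x₀ ε, ∀ x₂ ∈ closedBallInterp i ν x₀ ε,
        normE1 i ν τ (u x₁ - u x₂) ≤ σ * interpNorm i ν (x₁ - x₂) := by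
  have hμν := hμβ.trans hβν
  have hν := hμ.trans_le hμν
  obtain ⟨r, hr, L, hrV, hA, hF⟩ :=
    exists_interpLipschitzOn_closedBall hμ.le hμβ hβν hV hAF₁ hF₂ hx₀
  obtain ⟨T, hT, C, hC, hlin⟩ := exists_hasMaxRegBound hi hμ hμν hν1 (hAF₁.1 x₀ hx₀.1)
  obtain ⟨τ, ε, hεr, hCεr, H⟩ := exists_isContractionRegime hν hν1 hT hC hlin hx₀.2 hr hA hF
  choose! u hu htube using fun x (hx : x ∈ closedBallInterp i ν x₀ ε) =>
    H.exists_isPrimitive hν hν1 hx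
  refine ⟨τ, H.time_pos, ε, H.radius_pos, 1 + (1 + ‖A x₀‖) * (2 * C), by positivity, u,
    fun x hx => (isSolution_iff hν H.time_pos (A x₀)).2
      ⟨hrV (closedBallInterp_mono hεr hx), fun t ht => ?_, hu x hx⟩,
    fun x₁ hx₁ x₂ hx₂ => H.normE1_sub_le hν hν1 (hu x₁ hx₁) (hu x₂ hx₂) (htube x₁ hx₁)
      (htube x₂ hx₂)⟩
  exact hrV ⟨apply_mem_interpSpace hν1 _, (htube x hx t ht).2.trans hCεr⟩

end Existence

end ContMaxReg

theorem proposition2p5_general {E₀ E₁ : Type*} [NormedAddCommGroup E₀] [NormedSpace ℝ E₀]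
    [CompleteSpace E₀] [NormedAddCommGroup E₁] [NormedSpace ℝ E₁] [CompleteSpace E₁]
    (i : E₁ →L[ℝ] E₀) (hi : Function.Injective i)
    (μ β μ' : ℝ) (hμ : 0 < μ) (hμβ : μ < β) (hβμ' : β ≤ μ') (hμ' : μ' < 1)
    (V : Set E₀) (hV : IsOpenInterp i μ V)
    (A : E₀ → E₁ →L[ℝ] E₀) (F₁ F₂ : E₀ → E₀)
    (hAF₁ : LocLipCoefficients i μ V A F₁) (hF₂ : SingularStructure i μ β V F₂)
    (x₀ : E₀) (hx₀ : x₀ ∈ V ∩ interpSpace i μ') :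
    ∃ τ > 0, ∃ ε > 0, ∃ σ > 0, ∃ u : E₀ → ℝ → E₁,
      (∀ x ∈ closedBallInterp i μ' x₀ ε,
        IsSolution i μ' τ V A F₁ F₂ x (u x) ∧
        ∀ v, IsSolution i μ' τ V A F₁ F₂ x v → EqOn v (u x) (Ioc 0 τ)) ∧
      (∀ x₁ ∈ closedBallInterp i μ' x₀ ε, ∀ x₂ ∈ closedBallInterp i μ' x₀ ε,
        normE1 i μ' τ (u x₁ - u x₂) ≤ σ * interpNorm i μ' (x₁ - x₂)) ∧
      (∀ x ∈ closedBallInterp i μ' x₀ ε,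
        IsSolution i μ τ V A F₁ F₂ x (u x) ∧
        ∀ T > 0, ∀ v, IsSolution i μ T V A F₁ F₂ x v →
          EqOn v (u x) (Ioc 0 (min T τ)) ∧ IsSolution i μ' T V A F₁ F₂ x v) := by
  have hμμ' := hμβ.le.trans hβμ'
  obtain ⟨τ, hτ, ε, hε, σ, hσ, u, hu, hlip⟩ :=
    exists_lipschitz_solutionMap hi hμ hμβ.le hβμ' hμ' hV hAF₁ hF₂ hx₀
  have huμ : ∀ x ∈ closedBallInterp i μ' x₀ ε, IsSolution i μ τ V A F₁ F₂ x (u x) :=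
    fun x hx => (hu x hx).anti_weight hμ hμμ' hτ
  have hunique : ∀ x ∈ closedBallInterp i μ' x₀ ε, ∀ T > 0, ∀ v,
      IsSolution i μ T V A F₁ F₂ x v → EqOn v (u x) (Ioc 0 (min T τ)) := fun x hx T hT v hv =>
    (hv.mono_right hμ (lt_min hT hτ) (min_le_left _ _)).eqOn hi hμ hμβ (hβμ'.trans_lt hμ') hAF₁
      hF₂ (lt_min hT hτ) ((huμ x hx).mono_right hμ (lt_min hT hτ) (min_le_right _ _))
  refine ⟨τ, hτ, ε, hε, σ, hσ, u, fun x hx => ⟨hu x hx, fun v hv => ?_⟩, hlip,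
    fun x hx => ⟨huμ x hx, fun T hT v hv => ⟨hunique x hx T hT v hv, ?_⟩⟩⟩
  · simpa using hunique x hx τ hτ v (hv.anti_weight hμ hμμ' hτ)
  · exact hv.of_eventuallyEq hμ (hμ.trans_le hμμ') hτ hT (hu x hx)
      ((hunique x hx T hT v hv).eventuallyEq_of_mem (Ioc_mem_nhdsGT (lt_min hT hτ)))

theorem proposition2p5 {E₀ E₁ : Type*} [NormedAddCommGroup E₀] [NormedSpace ℝ E₀]
    [CompleteSpace E₀] [NormedAddCommGroup E₁] [NormedSpace ℝ E₁] [CompleteSpace E₁]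
    (i : E₁ →L[ℝ] E₀) (hi : Function.Injective i) (hd : DenseRange i)
    (μ β μ' : ℝ) (hμ : 0 < μ) (hμβ : μ < β) (hβμ' : β ≤ μ') (hμ' : μ' < 1)
    (V : Set E₀) (hV : IsOpenInterp i μ V)
    (A : E₀ → E₁ →L[ℝ] E₀) (F₁ F₂ : E₀ → E₀)
    (hAF₁ : LocLipCoefficients i μ V A F₁) (hF₂ : SingularStructure i μ β V F₂)
    (x₀ : E₀) (hx₀ : x₀ ∈ V ∩ interpSpace i μ') :
    ∃ τ > 0, ∃ ε > 0, ∃ σ > 0, ∃ u : E₀ → ℝ → E₁,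
      -- existence and uniqueness in the space with weight `μ'`
      (∀ x ∈ closedBallInterp i μ' x₀ ε,
        IsSolution i μ' τ V A F₁ F₂ x (u x) ∧
        ∀ v, IsSolution i μ' τ V A F₁ F₂ x v → EqOn v (u x) (Ioc 0 τ)) ∧
      -- Lipschitz dependence on the initial value
      (∀ x₁ ∈ closedBallInterp i μ' x₀ ε, ∀ x₂ ∈ closedBallInterp i μ' x₀ ε,
        normE1 i μ' τ (u x₁ - u x₂) ≤ σ * interpNorm i μ' (x₁ - x₂)) ∧
      -- the solutions are the solutions in the space with weight `μ`: `u x` is one of them, and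
      -- any other one agrees with `u x` on the common interval and has the weight `μ'` as well
      (∀ x ∈ closedBallInterp i μ' x₀ ε,
        IsSolution i μ τ V A F₁ F₂ x (u x) ∧
        ∀ T > 0, ∀ v, IsSolution i μ T V A F₁ F₂ x v →
          EqOn v (u x) (Ioc 0 (min T τ)) ∧ IsSolution i μ' T V A F₁ F₂ x v) := by
  exact proposition2p5_general i hi μ β μ' hμ hμβ hβμ' hμ' V hV A F₁ F₂ hAF₁ hF₂ x₀ hx₀
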